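/- Let $h:\mathbb{R}\to\mathbb{R}$ be a $C^\infty$ function with $h(t)=\sum_{m\ge 0}h_m t^m$ for all $t\in\mathbb{R}$, where $h_m\ge 0$ for all $m$, and let $\tau\in\mathbb{R}$. Then there are positive constants $C_{1,n}, C_{2,n}$ $(n\in\mathbb{N}_0)$, depending only on $h$, $\tau$ and $n$, such that the following holds for every dimension $d$ and all $\sigma_1,\dots,\sigma_d>0$ with $\sigma_1+\dots+\sigma_d\le\tau$. Let $\Sigma=\mathrm{diag}(\sigma_1,\dots,\sigma_d)$, let $\mu=\mathcal{N}(0,\Sigma)$ on $\mathbb{R}^d$, and let $k(x,x')=h(\langle x,x'\rangle)$. Assume that $k$ has finite Hilbert–Schmidt norm, $\iint k(x,x')^2\,\mu(\mathrm{d}x)\,\mu(\mathrm{d}x')<\infty$ (which holds in particular if $k$ is trace-class), and let $Tf(x)=\int k(x,x')f(x')\,\mu(\mathrm{d}x')$ be its integral operator on $L^2(\mu)$. Then the eigenvalues of $T$, counted with multiplicity, can be indexed by the multi-indices, i.e. $L^2(\mu)$ has an orthonormal basis $(e_\beta)_{\beta\in\mathbb{Z}^d_{\ge 0}}$ with $Te_\beta=\lambda_\beta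 e_\beta$, in such a way that $$C_{1,|\beta|}\,\sigma_1^{\beta_1}\cdots\sigma_d^{\beta_d}\;\le\;\lambda_\beta\;\le\;C_{2,|\beta|}\,\sigma_1^{\beta_1}\cdots\sigma_d^{\beta_d},\qquad |\beta|=\beta_1+\dots+\beta_d,$$ for every $\beta\in\mathbb{Z}^d_{\ge 0}$ such that $h_m>0$ for all $m\le|\beta|$ with $m\equiv|\beta| \pmod 2$. In particular, if $h_m>0$ for all $m$, the bounds hold for every $\beta$, hence for every eigenvalue of $T$. -/

import Mathlib

open MeasureTheory ProbabilityTheory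
open scoped NNReal ENNReal ContDiff

noncomputable section

/-- The centred Gaussian measure on `ℝ^d` with covariance matrix `diag (σ₁, …, σ_d)`: the
coordinates are independent, the `i`-th one being `N(0, σ i)` (so `σ i` is a variance). -/
def diagGaussian {d : ℕ} (σ : Fin d → ℝ≥0) : Measure (Fin d → ℝ) :=
  Measure.pi fun i => gaussianReal 0 (σ i)

/-- The inner-product kernel `k(x, x') = h(⟨x, x'⟩)` on `ℝ^d`. -/
def innerProductKernel (h : ℝ → ℝ) (d : ℕ) (x x' : Fin d → ℝ) : ℝ :=
  h (∑ i, x i * x' i)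

/-- `h` is a smooth function with an everywhere convergent power series expansion
`h t = ∑ m, a m * t ^ m` whose coefficients are nonnegative. -/
structure IsNonnegSeries (h : ℝ → ℝ) (a : ℕ → ℝ) : Prop where
  contDiff : ContDiff ℝ ∞ h
  nonneg : ∀ m, 0 ≤ a m
  hasSum : ∀ t, HasSum (fun m => a m * t ^ m) (h t)

/-- The kernel `k` has finite Hilbert-Schmidt norm: `∫∫ k(x, x')² μ(dx) μ(dx') < ∞`. -/
def IsHilbertSchmidtKernel {X : Type*} [MeasurableSpace X] (k : X → X → ℝ) (μ : Measure X) :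
    Prop :=
  MemLp (fun p : X × X => k p.1 p.2) 2 (μ.prod μ)

/-- The integral operator of the kernel `k`: `(T f)(x) = ∫ k(x, x') f(x') μ(dx')`. -/
def integralOperator {X : Type*} [MeasurableSpace X] (k : X → X → ℝ) (μ : Measure X)
    (f : X → ℝ) : X → ℝ :=
  fun x => ∫ x', k x x' * f x' ∂μ

/-- `e` is an orthonormal basis (complete orthonormal system) of `L²(μ)` consisting of
eigenfunctions of the integral operator of `k`, with eigenvalues `lam`. Thus `lam` lists all the
eigenvalues of the operator, each with its multiplicity. -/
def IsEigenbasis {X ι : Type*} [MeasurableSpace X] (k : X → X → ℝ) (μ : Measure X)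
    (e : HilbertBasis ι ℝ (Lp ℝ 2 μ)) (lam : ι → ℝ) : Prop :=
  ∀ j, integralOperator k μ (e j) =ᵐ[μ] fun x => lam j * e j x

end

/-! Expanding `h` gives the quadratic form `⟪T f, f⟫ = ∑ α, a |α| * multinomial α * ⟪x ^ α, f⟫ ^ 2`,
so `T` is a norm limit of finite-rank positive operators. It is tested on the normalized Hermite
products `u β`, which are not eigenvectors but almost diagonalize the form degree by degree. Write
`w β = ∏ σ i ^ β i`. On combinations of Hermite products of one degree `n` the form is at most `K n
* ∑ w β * b β ^ 2` (`exists_inner_operator_le`). If the coefficients of degree at most `n` and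
parity of `n` are positive, then `∑ w β * ⟪u β, f⟫ ^ 2 ≤ L n * ⟪T f, f⟫` for every `f`
(`exists_sum_inner_sq_le_operator`). Both constants are free of the dimension, because the products
over coordinates are dominated by `exp (C * ∑ σ i)`.

The two bounds confine a degree-`n` combination, up to a small relative error, to eigenvectors with
eigenvalue in `[s² w β, w β / s²]` for some `β` involved, provided `s = s n` is small
(`sum_inner_sq_le_of_forms`). The errors are summable over degrees, so a dimension count gives
Hall's condition for these windows. Compactness makes the windows finite, and the marriage theorem
yields an injection from multi-indices to eigenvectors with comparable eigenvalues
(`exists_injective_eigenvalue_comparable`).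

This injection need not be onto. Since the constants may depend on the degree, taking `s n ^ 2 ≤ 1 /
n!` makes the required inequalities hold for any given positive eigenvalue and all pure powers of
large degree in one coordinate. This gives an injection the other way
(`exists_injective_multiIndex`), and a Schröder–Bernstein argument that preserves the comparison
relation gives the bijection. -/

/-! ### Spectral theory of compact symmetric operators. -/

theorem exists_hilbertBasis_eigenvectors.{u} {H : Type u} [NormedAddCommGroup H]
    [InnerProductSpace ℝ H] [CompleteSpace H] (T : H →L[ℝ] H) (hT : IsCompactOperator T)
    (hT' : (T : H →ₗ[ℝ] H).IsSymmetric) :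
    ∃ (J : Type u) (e : HilbertBasis J ℝ H) (lam : J → ℝ), ∀ j, T (e j) = lam j • e j := by
  have hc (μ : ℝ) : CompleteSpace (Module.End.eigenspace (T : Module.End ℝ H) μ) := by
    have : IsClosed ((Module.End.eigenspace (T : Module.End ℝ H) μ : Submodule ℝ H) : Set H) := by
      have h : ((Module.End.eigenspace (T : Module.End ℝ H) μ : Submodule ℝ H) : Set H)
          = {x | T x = μ • x} := by
        ext x
        simp
      rw [h]
      exact isClosed_eq T.continuous (by fun_prop)
    exact this.completeSpace_coe
  choose w b hb using fun μ : ℝ =>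
    exists_hilbertBasis ℝ (Module.End.eigenspace (T : Module.End ℝ H) μ)
  have ho := hT'.orthogonalFamily_eigenspaces.orthonormal_sigma_orthonormal
    (fun μ => (b μ).orthonormal)
  have hbot : (Submodule.span ℝ (Set.range fun a : Σ μ, w μ =>
      ((Module.End.eigenspace (T : Module.End ℝ H) a.1).subtypeₗᵢ) (b a.1 a.2)))ᗮ = ⊥ := by
    rw [← ContinuousLinearMap.orthogonalComplement_iSup_eigenspaces_eq_bot hT hT']
    apply le_antisymm
    · rw [← Submodule.iInf_orthogonal]
      refine le_iInf fun μ x hx => ?_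
      rw [Submodule.mem_orthogonal'] at hx ⊢
      intro y hy
      set y' : Module.End.eigenspace (T : Module.End ℝ H) μ := ⟨y, hy⟩
      have hs := (b μ).hasSum_repr y'
      have hs' := (hs.mapL ((innerSL ℝ x).comp
        (Module.End.eigenspace (T : Module.End ℝ H) μ).subtypeL))
      have h0 : ∀ i, ((innerSL ℝ x).comp
        (Module.End.eigenspace (T : Module.End ℝ H) μ).subtypeL) ((b μ).repr y' i • b μ i) = 0 := by
        intro i
        have := hx (b μ i : H) (Submodule.subset_span ⟨⟨μ, i⟩, rfl⟩)
        simp [this]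
      simp only [h0] at hs'
      exact hs'.unique hasSum_zero
    · apply Submodule.orthogonal_le
      rw [Submodule.span_le]
      rintro _ ⟨a, rfl⟩
      exact Submodule.mem_iSup_of_mem a.1 (b a.1 a.2).2
  refine ⟨Σ μ, w μ, HilbertBasis.mkOfOrthogonalEqBot ho hbot, fun a => a.1, fun a => ?_⟩
  rw [HilbertBasis.coe_mkOfOrthogonalEqBot]
  exact Module.End.mem_eigenspace_iff.1 (b a.1 a.2).2

/-- Infinitely many orthonormal eigenvectors with eigenvalue at least `c` would have `c`-separated
images, contradicting compactness. This is what makes Hall's theorem applicable to infinitely many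
multi-indices. -/
theorem finite_setOf_le_eigenvalue {H J : Type*} [NormedAddCommGroup H]
    [InnerProductSpace ℝ H] (T : H →L[ℝ] H) (hT : IsCompactOperator T)
    {e : J → H} (he : Orthonormal ℝ e) {lam : J → ℝ} (hlam : ∀ j, T (e j) = lam j • e j)
    {c : ℝ} (hc : 0 < c) : {j | c ≤ lam j}.Finite := by
  by_contra hinf
  obtain ⟨φ, hφ, hφ'⟩ : ∃ φ : ℕ → J, Function.Injective φ ∧ ∀ n, c ≤ lam (φ n) := by
    have := Set.Infinite.natEmbedding _ hinf
    exact ⟨fun n => this n, fun a b hab => this.injective (Subtype.ext hab), fun n => (this n).2⟩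
  obtain ⟨K, hK, hK'⟩ := IsCompactOperator.image_closedBall_subset_compact (f := (T : H →ₗ[ℝ] H)) hT 1
  obtain ⟨a, -, ψ, hψ, hlim⟩ := hK.tendsto_subseq (x := fun n => T (e (φ n)))
    (fun n => hK' ⟨e (φ n), by simp [he.1], rfl⟩)
  have hC := hlim.cauchySeq
  rw [Metric.cauchySeq_iff'] at hC
  obtain ⟨N, hN⟩ := hC c hc
  have h1 := hN (N + 1) (by omega)
  have hne : φ (ψ (N + 1)) ≠ φ (ψ N) := fun h => by
    have := hψ.injective (hφ h)
    omega
  simp only [Function.comp, hlam, dist_eq_norm] at h1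
  have h2 : inner ℝ (e (φ (ψ (N + 1)))) (lam (φ (ψ (N + 1))) • e (φ (ψ (N + 1)))
      - lam (φ (ψ N)) • e (φ (ψ N))) = lam (φ (ψ (N + 1))) := by
    rw [inner_sub_right, inner_smul_right, inner_smul_right, he.2 hne,
      real_inner_self_eq_norm_sq, he.1]
    simp
  have h3 := real_inner_le_norm (e (φ (ψ (N + 1)))) (lam (φ (ψ (N + 1))) • e (φ (ψ (N + 1)))
      - lam (φ (ψ N)) • e (φ (ψ N)))
  rw [h2, he.1, one_mul] at h3
  linarith [hφ' (ψ (N + 1))]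

/-! ### Selecting distinct eigenvectors by the marriage theorem. -/

/-- A Hall-type selection: if the span of the vectors `u β` with `γ β = g` is, up to a small error,
contained in the span of the basis vectors selected by the sets `t β`, then these sets have a system
of distinct representatives. -/
theorem exists_injective_mem_of_almost_spanned {H J S : Type*} [NormedAddCommGroup H]
    [InnerProductSpace ℝ H] [CompleteSpace H] (e : HilbertBasis J ℝ H) {u : S → H}
    (hu : Orthonormal ℝ u) (γ : S → ℕ) (t : S → Finset J)
    (h : ∀ (g : ℕ) (B : Finset S), (∀ β ∈ B, γ β = g) → ∀ (a : S → ℝ) (F : Finset J),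
      (∀ β ∈ B, Disjoint F (t β)) →
      ∑ j ∈ F, (inner ℝ (e j) (∑ β ∈ B, a β • u β)) ^ 2 ≤ (1 / 4) ^ (g + 2) * ∑ β ∈ B, a β ^ 2) :
    ∃ f : S → J, Function.Injective f ∧ ∀ β, f β ∈ t β := by
  classical
  rw [← Finset.all_card_le_biUnion_card_iff_exists_injective]
  intro B
  by_contra hlt
  push Not at hlt
  -- If Hall's condition fails on `B`, there are fewer selected basis vectors than `u β`, so some
  -- nonzero combination is orthogonal to all of them. The error bounds will leave it at most half
  -- of its norm, contradicting Parseval.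
  obtain ⟨a, ha, ⟨β₀, hβ₀, hne⟩⟩ : ∃ a : S → ℝ,
      (∀ j ∈ B.biUnion t, inner ℝ (e j) (∑ β ∈ B, a β • u β) = 0) ∧ ∃ β ∈ B, a β ≠ 0 := by
    let L : (B → ℝ) →ₗ[ℝ] (B.biUnion t → ℝ) :=
      LinearMap.pi fun j => ∑ β : B, (inner ℝ (e j) (u β)) • LinearMap.proj β
    have hL : ¬ Function.Injective L := fun hi => by
      have := LinearMap.finrank_le_finrank_of_injective hi
      simp only [Module.finrank_fintype_fun_eq_card, Fintype.card_coe] at this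
      omega
    rw [← LinearMap.ker_eq_bot, Submodule.eq_bot_iff] at hL
    push Not at hL
    obtain ⟨a, ha, hne⟩ := hL
    refine ⟨fun β => if hβ : β ∈ B then a ⟨β, hβ⟩ else 0, fun j hj => ?_, ?_⟩
    · have := congrFun ((LinearMap.mem_ker).1 ha) ⟨j, hj⟩
      simp only [L, LinearMap.pi_apply, LinearMap.sum_apply, LinearMap.smul_apply,
        LinearMap.proj_apply, smul_eq_mul, Pi.zero_apply] at this
      rw [inner_sum, ← Finset.sum_coe_sort, ← this]
      refine Finset.sum_congr rfl fun β _ => ?_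
      simp [inner_smul_right, mul_comm]
    · obtain ⟨β, hβ⟩ := Function.ne_iff.1 hne
      exact ⟨β, β.2, by simpa using hβ⟩
  set v := ∑ β ∈ B, a β • u β with hv
  have hnorm : ∀ B' : Finset S, ‖∑ β ∈ B', a β • u β‖ ^ 2 = ∑ β ∈ B', a β ^ 2 := by
    intro B'
    rw [← real_inner_self_eq_norm_sq, hu.inner_sum]
    simp [sq]
  have hvpos : 0 < ‖v‖ := by
    have : 0 < ‖v‖ ^ 2 := by
      rw [hnorm]
      exact Finset.sum_pos' (fun _ _ => sq_nonneg _) ⟨β₀, hβ₀, by positivity⟩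
    by_contra h0
    rw [le_antisymm (not_lt.1 h0) (norm_nonneg v)] at this
    norm_num at this
  have hsum : HasSum (fun j => (inner ℝ (e j) v) ^ 2) (‖v‖ ^ 2) := by
    have := e.hasSum_inner_mul_inner v v
    rw [real_inner_self_eq_norm_sq] at this
    refine this.congr_fun ?_
    intro j
    rw [real_inner_comm, sq]
  have key : ∀ F : Finset J, ∑ j ∈ F, (inner ℝ (e j) v) ^ 2 ≤ (‖v‖ / 2) ^ 2 := by
    intro F
    set F' := F \ B.biUnion t
    have h1 : ∑ j ∈ F, (inner ℝ (e j) v) ^ 2 = ∑ j ∈ F', (inner ℝ (e j) v) ^ 2 := by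
      symm
      refine Finset.sum_subset Finset.sdiff_subset fun j hj hj' => ?_
      have : j ∈ B.biUnion t := by
        by_contra h
        exact hj' (Finset.mem_sdiff.2 ⟨hj, h⟩)
      rw [ha j this]
      simp
    rw [h1]
    -- Reading off the coordinates in `F'` as a Euclidean vector allows the triangle inequality over
    -- the groups `γ β = g`, whose errors `(1 / 2) ^ (g + 2) * ‖v‖` add up to at most `‖v‖ / 2`.
    let Q : H →ₗ[ℝ] EuclideanSpace ℝ F' :=
      (WithLp.linearEquiv 2 ℝ (F' → ℝ)).symm.toLinearMap.comp
        (LinearMap.pi fun j : F' => (innerSL ℝ (e j)).toLinearMap)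
    have hQ : ∀ x, ‖Q x‖ ^ 2 = ∑ j ∈ F', (inner ℝ (e j) x) ^ 2 := by
      intro x
      rw [EuclideanSpace.norm_sq_eq, ← Finset.sum_coe_sort F' (fun j => (inner ℝ (e j) x) ^ 2)]
      simp [Q]
    rw [← hQ]
    have hvg : v = ∑ g ∈ B.image γ, ∑ β ∈ B with γ β = g, a β • u β := by
      rw [hv, Finset.sum_fiberwise_of_maps_to]
      exact fun β hβ => Finset.mem_image_of_mem _ hβ
    have hg : ∀ g, ‖Q (∑ β ∈ B with γ β = g, a β • u β)‖ ≤ (1 / 2) ^ (g + 2) * ‖v‖ := by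
      intro g
      refine (sq_le_sq₀ (norm_nonneg _) (by positivity)).1 ?_
      rw [hQ]
      refine (h g _ (by simp) a F' fun β hβ => ?_).trans ?_
      · rw [Finset.disjoint_left]
        intro j hj hj'
        exact (Finset.mem_sdiff.1 hj).2 (Finset.mem_biUnion.2 ⟨β, (Finset.mem_filter.1 hβ).1, hj'⟩)
      · rw [mul_pow, hnorm, ← pow_mul, mul_comm (g + 2) 2, pow_mul]
        norm_num
        exact Finset.sum_le_sum_of_subset_of_nonneg (Finset.filter_subset _ _)
          fun _ _ _ => sq_nonneg _
    have hQv : ‖Q v‖ ≤ ‖v‖ / 2 := by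
      calc ‖Q v‖ = ‖∑ g ∈ B.image γ, Q (∑ β ∈ B with γ β = g, a β • u β)‖ := by
            conv_lhs => rw [hvg]
            rw [map_sum]
        _ ≤ ∑ g ∈ B.image γ, (1 / 2) ^ (g + 2) * ‖v‖ :=
            (norm_sum_le _ _).trans (Finset.sum_le_sum fun g _ => hg g)
        _ = (∑ g ∈ B.image γ, (1 / 2 : ℝ) ^ g) * (‖v‖ / 4) := by
            rw [Finset.sum_mul]
            refine Finset.sum_congr rfl fun g _ => by ring
        _ ≤ 2 * (‖v‖ / 4) := by
            gcongr
            have := Summable.sum_le_tsum (B.image γ) (fun _ _ => by positivity)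
              summable_geometric_two
            rwa [tsum_geometric_two] at this
        _ = ‖v‖ / 2 := by ring
    gcongr
  have := hasSum_le_of_sum_le hsum key
  nlinarith

/-! ### Localizing vectors spectrally from two-sided form bounds. -/

theorem Finset.sum_half_pow_natAbs_sub_le (A : Finset ℤ) (m : ℤ) :
    ∑ k ∈ A, (1 / 2 : ℝ) ^ (k - m).natAbs ≤ 4 := by
  have h (B : Finset ℤ) (hB : Set.InjOn (fun k : ℤ => (k - m).natAbs) B) :
      ∑ k ∈ B, (1 / 2 : ℝ) ^ (k - m).natAbs ≤ 2 := by
    rw [← Finset.sum_image (f := fun n : ℕ => (1 / 2 : ℝ) ^ n) hB]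
    have := Summable.sum_le_tsum (B.image fun k : ℤ => (k - m).natAbs) (fun _ _ => by positivity)
      summable_geometric_two
    rwa [tsum_geometric_two] at this
  rw [← Finset.sum_filter_add_sum_filter_not A (fun k => m ≤ k)]
  have h1 := h {k ∈ A | m ≤ k} (by
    intro a ha b hb hab
    simp only [Finset.coe_filter, Set.mem_ofPred_eq] at ha hb hab
    omega)
  have h2 := h {k ∈ A | ¬ m ≤ k} (by
    intro a ha b hb hab
    simp only [Finset.coe_filter, Set.mem_ofPred_eq] at ha hb hab
    omega)
  linarith

/-- With `x = lam / 4 ^ k`, the left side is at most `√x` or `2 / √x`. Outside the window `x` is so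
large or so small that these square roots gain a factor of order `s` over `x` or `1 / x`. The gain
provides both the smallness and the geometric decay needed to sum over scales `k`. -/
theorem two_pow_natAbs_sub_log_le {lam s : ℝ} (hlam : 0 < lam) (hs : 0 < s) (hs' : s ≤ 1 / 2)
    (k : ℤ) (h : lam < s ^ 2 * 4 ^ (k + 1) ∨ 4 ^ k / s ^ 2 < lam) :
    (2 : ℝ) ^ (k - Int.log 4 lam).natAbs ≤ 8 * s * (lam * (4 ^ k)⁻¹ + 4 ^ k * lam⁻¹) := by
  set m := Int.log 4 lam
  have hm1 : (4 : ℝ) ^ m ≤ lam := by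
    have := Int.zpow_log_le_self (b := 4) (by norm_num) hlam
    exact_mod_cast this
  have hm2 : lam < (4 : ℝ) ^ (m + 1) := by
    have := Int.lt_zpow_succ_log_self (b := 4) (by norm_num) lam
    exact_mod_cast this
  have h4k : (0 : ℝ) < 4 ^ k := by positivity
  set x := lam * (4 ^ k)⁻¹ with hx
  have hx0 : 0 < x := by positivity
  have hxi : 4 ^ k * lam⁻¹ = x⁻¹ := by
    rw [hx]
    field_simp
  have hlx : lam = x * 4 ^ k := by
    rw [hx]
    field_simp
  rw [hxi]
  have hsq : ((2 : ℝ) ^ (k - m).natAbs) ^ 2 = 4 ^ (k - m).natAbs := by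
    rw [← pow_mul, mul_comm, pow_mul]
    norm_num
  have hp : (4 : ℝ) ^ (k - m).natAbs ≤ x ∧ 1 ≤ x ∨ (4 : ℝ) ^ (k - m).natAbs ≤ 4 * x⁻¹ ∧ x ≤ 1 := by
    rcases le_or_gt k m with hkm | hkm
    · left
      have h1 : (4 : ℝ) ^ (k - m).natAbs * 4 ^ k = 4 ^ m := by
        rw [← zpow_natCast, ← zpow_add₀ (by norm_num)]
        congr 1
        omega
      have h2 : (4 : ℝ) ^ (k - m).natAbs ≤ x := by
        rw [← h1, hlx] at hm1
        exact le_of_mul_le_mul_right hm1 h4k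
      exact ⟨h2, (one_le_pow₀ (by norm_num)).trans h2⟩
    · right
      have h1 : (4 : ℝ) ^ (k - m).natAbs * 4 ^ (m + 1) = 4 * 4 ^ k := by
        rw [← zpow_natCast, ← zpow_add₀ (by norm_num), mul_comm, ← zpow_add_one₀ (by norm_num)]
        congr 1
        omega
      have h3 : lam ≤ 4 ^ k := hm2.le.trans (zpow_le_zpow_right₀ (by norm_num) (by omega))
      refine ⟨?_, ?_⟩
      · rw [← div_eq_mul_inv, le_div_iff₀ hx0]
        refine le_of_mul_le_mul_right ?_ h4k
        rw [mul_assoc, ← hlx, ← h1]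
        gcongr
      · rw [hx, ← div_eq_mul_inv]
        exact div_le_one_of_le₀ h3 h4k.le
  have hxs : x < 4 * s ^ 2 ∨ 1 / s ^ 2 < x := by
    rcases h with h | h
    · left
      rw [hlx, zpow_add_one₀ (by norm_num)] at h
      refine lt_of_mul_lt_mul_right (h.trans_eq ?_) h4k.le
      ring
    · right
      rw [hlx] at h
      refine lt_of_mul_lt_mul_right (lt_of_eq_of_lt ?_ h) h4k.le
      ring
  have hs4 : s ^ 2 ≤ 1 / 4 := by nlinarith
  have hxinv : 0 < x⁻¹ := by positivity
  rcases hxs with hxs | hxs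
  · have hx1 : x < 1 := by linarith
    have h5 : (4 : ℝ) ^ (k - m).natAbs ≤ 4 * x⁻¹ := by
      rcases hp with hp | hp
      · linarith [hp.2]
      · exact hp.1
    have h6 : (2 : ℝ) ^ (k - m).natAbs ≤ 4 * s * x⁻¹ := by
      refine (sq_le_sq₀ (by positivity) (by positivity)).1 ?_
      rw [hsq]
      refine h5.trans ?_
      have : 1 ≤ 4 * s ^ 2 * x⁻¹ := by
        rw [← div_eq_mul_inv, le_div_iff₀ hx0]
        linarith
      calc 4 * x⁻¹ = 4 * x⁻¹ * 1 := by ring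
        _ ≤ 4 * x⁻¹ * (4 * s ^ 2 * x⁻¹) := by gcongr
        _ = _ := by ring
    nlinarith [mul_pos hs hx0, mul_pos hs hxinv]
  · rw [div_lt_iff₀ (by positivity)] at hxs
    have hx4 : 4 < x := by nlinarith
    have h5 : (4 : ℝ) ^ (k - m).natAbs ≤ x := by
      rcases hp with hp | hp
      · exact hp.1
      · linarith [hp.2]
    have h6 : (2 : ℝ) ^ (k - m).natAbs ≤ s * x := by
      refine (sq_le_sq₀ (by positivity) (by positivity)).1 ?_
      rw [hsq]
      refine h5.trans ?_
      nlinarith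
    nlinarith [mul_pos hs hx0, mul_pos hs hxinv]

section EigenForm

variable {H J S : Type*} [NormedAddCommGroup H] [InnerProductSpace ℝ H]
  {T : H →L[ℝ] H} {e : HilbertBasis J ℝ H} {lam : J → ℝ}

theorem hasSum_eigenvalue_mul_inner_sq (hT : (T : H →ₗ[ℝ] H).IsSymmetric)
    (hlam : ∀ j, T (e j) = lam j • e j) (v : H) :
    HasSum (fun j => lam j * (inner ℝ (e j) v) ^ 2) (inner ℝ (T v) v) := by
  have := e.hasSum_inner_mul_inner (T v) v
  refine this.congr_fun fun j => ?_
  have h : inner ℝ (T v) (e j) = inner ℝ v (T (e j)) := hT v (e j)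
  rw [h, hlam, inner_smul_right, real_inner_comm (e j) v]
  ring

theorem sum_eigenvalue_mul_inner_sq_le (hT : (T : H →ₗ[ℝ] H).IsSymmetric)
    (hlam : ∀ j, T (e j) = lam j • e j) (h0 : ∀ j, 0 ≤ lam j) (v : H) (F : Finset J) :
    ∑ j ∈ F, lam j * (inner ℝ (e j) v) ^ 2 ≤ inner ℝ (T v) v :=
  sum_le_hasSum F (fun j _ => mul_nonneg (h0 j) (sq_nonneg _))
    (hasSum_eigenvalue_mul_inner_sq hT hlam v)

/-- Duality: a lower bound for the form of `T` is an upper bound for the form of its inverse. It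
follows by testing the hypothesis on the truncation of `T⁻¹ v` to `F` and applying Cauchy–Schwarz
with weights `w β`. -/
theorem sum_inv_eigenvalue_mul_inner_sq_le
    (hlam : ∀ j, T (e j) = lam j • e j) (h0 : ∀ j, 0 ≤ lam j) {u : S → H} {w : S → ℝ}
    (hw : ∀ β, 0 < w β) {L : ℝ} (hL0 : 0 ≤ L) (B : Finset S)
    (hL : ∀ f, ∑ β ∈ B, w β * (inner ℝ (u β) f) ^ 2 ≤ L * inner ℝ (T f) f)
    (a : S → ℝ) (F : Finset J) :
    ∑ j ∈ F, (lam j)⁻¹ * (inner ℝ (e j) (∑ β ∈ B, a β • u β)) ^ 2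
      ≤ L * ∑ β ∈ B, (w β)⁻¹ * a β ^ 2 := by
  set v := ∑ β ∈ B, a β • u β with hv
  set f := ∑ j ∈ F, ((lam j)⁻¹ * inner ℝ (e j) v) • e j with hf
  set X := ∑ j ∈ F, (lam j)⁻¹ * (inner ℝ (e j) v) ^ 2 with hX
  have hX0 : 0 ≤ X := Finset.sum_nonneg fun j _ => mul_nonneg (inv_nonneg.2 (h0 j)) (sq_nonneg _)
  have hTf : inner ℝ (T f) f = X := by
    have h1 : T f = ∑ j ∈ F, (lam j * ((lam j)⁻¹ * inner ℝ (e j) v)) • e j := by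
      rw [hf, map_sum]
      refine Finset.sum_congr rfl fun j _ => ?_
      rw [map_smul, hlam, smul_smul, mul_comm]
    rw [h1, hf, e.orthonormal.inner_sum, hX]
    refine Finset.sum_congr rfl fun j _ => ?_
    -- Null eigenvalues drop out of both sides, since `0⁻¹ = 0`.
    rcases eq_or_ne (lam j) 0 with h | h
    · simp [h]
    · simp only [conj_trivial]
      field_simp
  have hfv : inner ℝ v f = X := by
    rw [hf, inner_sum, hX]
    refine Finset.sum_congr rfl fun j _ => ?_
    rw [inner_smul_right, real_inner_comm (e j) v]
    ring
  have hfv' : inner ℝ v f = ∑ β ∈ B, a β * inner ℝ (u β) f := by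
    rw [hv, sum_inner]
    refine Finset.sum_congr rfl fun β _ => ?_
    rw [inner_smul_left]
    simp
  have hcs : X ^ 2 ≤ (∑ β ∈ B, (w β)⁻¹ * a β ^ 2) * ∑ β ∈ B, w β * (inner ℝ (u β) f) ^ 2 := by
    rw [← hfv, hfv']
    refine Finset.sum_sq_le_sum_mul_sum_of_sq_le_mul B
      (fun β _ => mul_nonneg (inv_nonneg.2 (hw β).le) (sq_nonneg _))
      (fun β _ => mul_nonneg (hw β).le (sq_nonneg _)) fun β _ => ?_
    have := (hw β).ne'
    refine le_of_eq ?_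
    field_simp
  have hA0 : 0 ≤ ∑ β ∈ B, (w β)⁻¹ * a β ^ 2 :=
    Finset.sum_nonneg fun β _ => mul_nonneg (inv_nonneg.2 (hw β).le) (sq_nonneg _)
  have hL' := hL f
  rw [hTf] at hL'
  have h2 : X * X ≤ (L * ∑ β ∈ B, (w β)⁻¹ * a β ^ 2) * X := by
    nlinarith [mul_le_mul_of_nonneg_left hL' hA0]
  rcases hX0.eq_or_lt with h | h
  · rw [← h]
    exact mul_nonneg hL0 hA0
  · exact le_of_mul_le_mul_right h2 h

/-- If the form of `T` is bounded above by `K w β` and below by `w β / L` on the span of the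
vectors `u β`, then this span is almost contained in the span of the eigenvectors whose eigenvalue is
comparable to one of the weights `w β`. -/
theorem sum_inner_sq_le_of_forms (hT : (T : H →ₗ[ℝ] H).IsSymmetric)
    (hlam : ∀ j, T (e j) = lam j • e j) (h0 : ∀ j, 0 ≤ lam j) {u : S → H} {w : S → ℝ}
    (hw : ∀ β, 0 < w β) {K L s : ℝ} (hK0 : 0 ≤ K) (hL0 : 0 ≤ L) (hs : 0 < s) (hs' : s ≤ 1 / 2)
    (B : Finset S) (a : S → ℝ)
    (hK : ∀ B' ⊆ B, inner ℝ (T (∑ β ∈ B', a β • u β)) (∑ β ∈ B', a β • u β)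
      ≤ K * ∑ β ∈ B', w β * a β ^ 2)
    (hL : ∀ B' ⊆ B, ∀ f, ∑ β ∈ B', w β * (inner ℝ (u β) f) ^ 2 ≤ L * inner ℝ (T f) f)
    (F : Finset J) (hF : ∀ j ∈ F, ∀ β ∈ B, lam j < s ^ 2 * w β ∨ w β / s ^ 2 < lam j) :
    ∑ j ∈ F, (inner ℝ (e j) (∑ β ∈ B, a β • u β)) ^ 2
      ≤ 32 * s * (4 * K + L) * ∑ β ∈ B, a β ^ 2 := by
  -- The weights are sorted into dyadic shells `4 ^ k ≤ w β < 4 ^ (k + 1)`, and `V k` is the part of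
  -- the vector in shell `k`.
  classical
  set κ : S → ℤ := fun β => Int.log 4 (w β)
  have hκ1 (β : S) : (4 : ℝ) ^ κ β ≤ w β := by
    have := Int.zpow_log_le_self (b := 4) (by norm_num) (hw β)
    exact_mod_cast this
  have hκ2 (β : S) : w β < (4 : ℝ) ^ (κ β + 1) := by
    have := Int.lt_zpow_succ_log_self (b := 4) (by norm_num) (w β)
    exact_mod_cast this
  set A := B.image κ
  set V : ℤ → H := fun k => ∑ β ∈ B with κ β = k, a β • u β with hV
  have hvV : ∑ β ∈ B, a β • u β = ∑ k ∈ A, V k := by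
    rw [hV, Finset.sum_fiberwise_of_maps_to]
    exact fun β hβ => Finset.mem_image_of_mem _ hβ
  have hpt : ∀ j ∈ F, (inner ℝ (e j) (∑ β ∈ B, a β • u β)) ^ 2 ≤
      32 * s * ∑ k ∈ A, ((4 ^ k)⁻¹ * (lam j * (inner ℝ (e j) (V k)) ^ 2)
        + 4 ^ k * ((lam j)⁻¹ * (inner ℝ (e j) (V k)) ^ 2)) := by
    intro j hj
    rcases (h0 j).eq_or_lt with hj0 | hj0
    -- For an eigenvector in the kernel, the lower form bound forces orthogonality to every `u β`.
    · have hz : ∀ β ∈ B, inner ℝ (e j) (u β) = 0 := by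
        intro β hβ
        have h1 := hL {β} (by simpa using hβ) (e j)
        simp only [hlam, ← hj0, Finset.sum_singleton, zero_smul, inner_zero_left, mul_zero] at h1
        have h2 : (inner ℝ (u β) (e j)) ^ 2 ≤ 0 := nonpos_of_mul_nonpos_right h1 (hw β)
        rw [real_inner_comm]
        nlinarith
      have : inner ℝ (e j) (∑ β ∈ B, a β • u β) = 0 := by
        rw [inner_sum]
        exact Finset.sum_eq_zero fun β hβ => by rw [inner_smul_right, hz β hβ, mul_zero]
      rw [this, ← hj0]
      simp
    · set m := Int.log 4 (lam j)
      have hk : ∀ k ∈ A, (2 : ℝ) ^ (k - m).natAbs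
          ≤ 8 * s * (lam j * (4 ^ k)⁻¹ + 4 ^ k * (lam j)⁻¹) := by
        intro k hk
        obtain ⟨β, hβ, rfl⟩ := Finset.mem_image.1 hk
        refine two_pow_natAbs_sub_log_le hj0 hs hs' _ ((hF j hj β hβ).imp (fun h => ?_) fun h => ?_)
        · refine h.trans_le ?_
          gcongr
          exact (hκ2 β).le
        · refine lt_of_le_of_lt ?_ h
          gcongr
          exact hκ1 β
      rw [hvV, inner_sum]
      -- Cauchy–Schwarz with weights decaying in the distance from shell `k` to the scale `m` of
      -- `lam j`, which avoids any loss in the number of shells. The constant is `32 = 4 * 8`.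
      have hcs : (∑ k ∈ A, inner ℝ (e j) (V k)) ^ 2 ≤ (∑ k ∈ A, (1 / 2 : ℝ) ^ (k - m).natAbs) *
          ∑ k ∈ A, (2 : ℝ) ^ (k - m).natAbs * (inner ℝ (e j) (V k)) ^ 2 := by
        refine Finset.sum_sq_le_sum_mul_sum_of_sq_le_mul A (fun _ _ => by positivity)
          (fun _ _ => by positivity) fun k _ => ?_
        rw [← mul_assoc, ← mul_pow]
        norm_num
      calc _ ≤ _ := hcs
        _ ≤ 4 * ∑ k ∈ A, 8 * s * (lam j * (4 ^ k)⁻¹ + 4 ^ k * (lam j)⁻¹)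
              * (inner ℝ (e j) (V k)) ^ 2 := by
            gcongr with k hkA
            · exact Finset.sum_half_pow_natAbs_sub_le A m
            · exact hk k hkA
        _ = _ := by
            rw [Finset.mul_sum, Finset.mul_sum]
            exact Finset.sum_congr rfl fun k _ => by ring
  calc _ ≤ ∑ j ∈ F, 32 * s * ∑ k ∈ A, ((4 ^ k)⁻¹ * (lam j * (inner ℝ (e j) (V k)) ^ 2)
        + 4 ^ k * ((lam j)⁻¹ * (inner ℝ (e j) (V k)) ^ 2)) := Finset.sum_le_sum hpt
    _ = 32 * s * ∑ k ∈ A, ((4 ^ k)⁻¹ * ∑ j ∈ F, lam j * (inner ℝ (e j) (V k)) ^ 2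
        + 4 ^ k * ∑ j ∈ F, (lam j)⁻¹ * (inner ℝ (e j) (V k)) ^ 2) := by
        rw [← Finset.mul_sum, Finset.sum_comm]
        simp_rw [Finset.sum_add_distrib, Finset.mul_sum]
    _ ≤ 32 * s * ∑ k ∈ A, (4 * K + L) * ∑ β ∈ B with κ β = k, a β ^ 2 := by
        gcongr with k hk
        have hsub : B.filter (fun β => κ β = k) ⊆ B := Finset.filter_subset _ _
        have h1 := (sum_eigenvalue_mul_inner_sq_le hT hlam h0 (V k) F).trans (hK _ hsub)
        have h2 := sum_inv_eigenvalue_mul_inner_sq_le hlam h0 hw hL0 _ (hL _ hsub) a F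
        have h3 : ∑ β ∈ B with κ β = k, w β * a β ^ 2 ≤
            4 ^ k * 4 * ∑ β ∈ B with κ β = k, a β ^ 2 := by
          rw [Finset.mul_sum]
          refine Finset.sum_le_sum fun β hβ => ?_
          gcongr
          have := (hκ2 β).le
          rwa [(Finset.mem_filter.1 hβ).2, zpow_add_one₀ (by norm_num)] at this
        have h4 : ∑ β ∈ B with κ β = k, (w β)⁻¹ * a β ^ 2 ≤
            (4 ^ k)⁻¹ * ∑ β ∈ B with κ β = k, a β ^ 2 := by
          rw [Finset.mul_sum]
          refine Finset.sum_le_sum fun β hβ => ?_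
          have := hκ1 β
          rw [(Finset.mem_filter.1 hβ).2] at this
          gcongr
        calc _ ≤ (4 ^ k)⁻¹ * (K * (4 ^ k * 4 * ∑ β ∈ B with κ β = k, a β ^ 2)) +
              4 ^ k * (L * ((4 ^ k)⁻¹ * ∑ β ∈ B with κ β = k, a β ^ 2)) := by
              gcongr
              · exact h1.trans (by gcongr)
              · exact h2.trans (by gcongr)
          _ = _ := by field_simp
    _ = _ := by
        rw [← Finset.mul_sum, Finset.sum_fiberwise_of_maps_to]
        · ring
        · exact fun β hβ => Finset.mem_image_of_mem _ hβ

end EigenForm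

/-! ### Injections in both directions between multi-indices and eigenvectors. -/

theorem exists_injective_eigenvalue_comparable {H J S : Type*} [NormedAddCommGroup H]
    [InnerProductSpace ℝ H] [CompleteSpace H] [Countable S]
    {T : H →L[ℝ] H} {e : HilbertBasis J ℝ H} {lam : J → ℝ} (hT : (T : H →ₗ[ℝ] H).IsSymmetric)
    (hlam : ∀ j, T (e j) = lam j • e j) (h0 : ∀ j, 0 ≤ lam j)
    (hfin : ∀ c > 0, {j | c ≤ lam j}.Finite) {u : S → H} (hu : Orthonormal ℝ u)
    {w : S → ℝ} (hw : ∀ β, 0 < w β) (deg : S → ℕ) (good : ℕ → Prop) {K L s : ℕ → ℝ}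
    (hK0 : ∀ n, 0 ≤ K n) (hL0 : ∀ n, 0 ≤ L n) (hs : ∀ n, 0 < s n) (hs' : ∀ n, s n ≤ 1 / 2)
    (hsKL : ∀ n, 32 * s n * (4 * K n + L n) ≤ (1 / 4) ^ (2 * n + 2))
    (hK : ∀ n, good n → ∀ B : Finset S, (∀ β ∈ B, deg β = n) → ∀ a : S → ℝ,
      inner ℝ (T (∑ β ∈ B, a β • u β)) (∑ β ∈ B, a β • u β) ≤ K n * ∑ β ∈ B, w β * a β ^ 2)
    (hL : ∀ n, good n → ∀ B : Finset S, (∀ β ∈ B, deg β = n) → ∀ f,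
      ∑ β ∈ B, w β * (inner ℝ (u β) f) ^ 2 ≤ L n * inner ℝ (T f) f) :
    ∃ f : S → J, Function.Injective f ∧ ∀ β, good (deg β) →
      s (deg β) ^ 2 * w β ≤ lam (f β) ∧ lam (f β) ≤ w β / s (deg β) ^ 2 := by
  classical
  obtain ⟨enc, henc⟩ := exists_injective_nat S
  have hfin' (β : S) : {j | s (deg β) ^ 2 * w β ≤ lam j ∧ lam j ≤ w β / s (deg β) ^ 2}.Finite :=
    (hfin (s (deg β) ^ 2 * w β) (mul_pos (pow_pos (hs _) 2) (hw β))).subset fun j hj => hj.1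
  have htail (β : S) : ∃ t : Finset J, ∀ F : Finset J, Disjoint F t →
      ∑ j ∈ F, (inner ℝ (e j) (u β)) ^ 2 ≤ (1 / 4) ^ (2 * enc β + 1 + 2) := by
    -- An index of bad degree only has to receive some eigenvector, so a finite set carrying almost
    -- all of the mass of `u β` serves in place of a window.
    have hsum := (e.hasSum_inner_mul_inner (u β) (u β)).summable
    obtain ⟨t, ht⟩ := summable_iff_vanishing_norm.1 hsum ((1 / 4) ^ (2 * enc β + 1 + 2))
      (by positivity)
    refine ⟨t, fun F hF => ?_⟩
    have := (le_abs_self _).trans (ht F hF).le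
    refine le_trans (le_of_eq (Finset.sum_congr rfl fun j _ => ?_)) this
    rw [real_inner_comm, sq]
  choose t ht using htail
  -- Even labels group the indices of one good degree; odd labels isolate each bad index by itself.
  -- All labels thus share one summable error budget.
  obtain ⟨f, hf, hft⟩ := exists_injective_mem_of_almost_spanned e hu
    (fun β => if good (deg β) then 2 * deg β else 2 * enc β + 1)
    (fun β => if good (deg β) then (hfin' β).toFinset else t β) (by
      intro g B hB a F hF
      rcases B.eq_empty_or_nonempty with rfl | ⟨β₀, hβ₀⟩
      · simp
      by_cases hg : good (deg β₀)
      · have hg' : g = 2 * deg β₀ := by rw [← hB β₀ hβ₀, if_pos hg]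
        have hBd : ∀ β ∈ B, good (deg β) ∧ deg β = deg β₀ := by
          intro β hβ
          have := hB β hβ
          split_ifs at this with h
          · exact ⟨h, by omega⟩
          · omega
        refine (sum_inner_sq_le_of_forms hT hlam h0 hw (hK0 (deg β₀)) (hL0 (deg β₀)) (hs (deg β₀))
          (hs' _) B a (fun B' hB' => hK _ hg B' (fun β hβ => (hBd β (hB' hβ)).2) a)
          (fun B' hB' => hL _ hg B' (fun β hβ => (hBd β (hB' hβ)).2)) F ?_).trans ?_
        · intro j hj β hβ
          have h1 := Finset.disjoint_left.1 (hF β hβ) hj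
          rw [if_pos (hBd β hβ).1, Set.Finite.mem_toFinset] at h1
          rw [Set.mem_ofPred_eq, not_and_or, not_le, not_le, (hBd β hβ).2] at h1
          exact h1
        · rw [hg']
          gcongr
          exact hsKL _
      · have hg' : g = 2 * enc β₀ + 1 := by rw [← hB β₀ hβ₀, if_neg hg]
        have hBs : B = {β₀} := by
          refine Finset.eq_singleton_iff_unique_mem.2 ⟨hβ₀, fun β hβ => ?_⟩
          have := hB β hβ
          split_ifs at this with h
          · omega
          · exact henc (by omega)
        subst hBs
        have h1 := hF β₀ hβ₀
        rw [if_neg hg] at h1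
        simp only [Finset.sum_singleton, inner_smul_right, mul_pow]
        rw [← Finset.mul_sum, mul_comm, hg']
        gcongr
        exact ht β₀ F h1)
  refine ⟨f, hf, fun β hβ => ?_⟩
  have := hft β
  rw [if_pos hβ, Set.Finite.mem_toFinset] at this
  exact this

/-- Only pure powers of one coordinate are used. Since `σ ^ n / n! → 0` and `n! * σ ^ n → ∞`, every
fixed positive eigenvalue eventually lies between the two bounds. Injectivity comes from encoding
`j` in the exponent. -/
theorem exists_injective_multiIndex {d : ℕ} (hd : d ≠ 0) {J : Type*} [Countable J] {lam : J → ℝ}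
    {σ : Fin d → ℝ} (hσ : ∀ i, 0 < σ i) (good : ℕ → Prop)
    (hbad : ∀ n l, ¬ good n → ¬ good (n + 2 * l)) (hpos : (∀ n, good n) → ∀ j, 0 < lam j)
    {c : ℕ → ℝ} (hc : ∀ n, 0 < c n) (hc' : ∀ n, c n ≤ 1 / (n.factorial : ℝ)) :
    ∃ g : J → (Fin d → ℕ), Function.Injective g ∧ ∀ j, good (∑ i, g j i) →
      c (∑ i, g j i) * ∏ i, σ i ^ g j i ≤ lam j ∧
        lam j ≤ (∏ i, σ i ^ g j i) / c (∑ i, g j i) := by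
  classical
  obtain ⟨enc, henc⟩ := exists_injective_nat J
  let i₀ : Fin d := ⟨0, Nat.pos_of_ne_zero hd⟩
  have hdeg (n : ℕ) : ∑ i, (Pi.single i₀ n : Fin d → ℕ) i = n := by simp
  have hprod (n : ℕ) : ∏ i, σ i ^ (Pi.single i₀ n : Fin d → ℕ) i = σ i₀ ^ n := by
    rw [Finset.prod_eq_single i₀]
    · simp
    · intro i _ hi
      simp [hi]
    · simp
  by_cases hall : ∀ n, good n
  · have hN (j : J) : ∃ N, ∀ n ≥ N, c n * σ i₀ ^ n ≤ lam j ∧ lam j ≤ σ i₀ ^ n / c n := by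
      have h1 := FloorSemiring.tendsto_pow_div_factorial_atTop (σ i₀)
      have h2 := FloorSemiring.tendsto_pow_div_factorial_atTop (σ i₀)⁻¹
      have e1 := h1.eventually (ge_mem_nhds (hpos hall j))
      have e2 := h2.eventually (ge_mem_nhds (inv_pos.2 (hpos hall j)))
      obtain ⟨N, hN⟩ := Filter.eventually_atTop.1 (e1.and e2)
      refine ⟨N, fun n hn => ⟨?_, ?_⟩⟩
      · refine le_trans ?_ (hN n hn).1
        rw [div_eq_mul_one_div, mul_comm]
        exact mul_le_mul_of_nonneg_left (hc' n) (pow_pos (hσ _) n).le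
      · have h3 := (hN n hn).2
        have hσn := pow_pos (hσ i₀) n
        have hl := hpos hall j
        rw [le_div_iff₀ (hc n)]
        have hf : (0 : ℝ) < n.factorial := by positivity
        rw [inv_pow, div_le_iff₀ hf, ← div_eq_inv_mul, le_div_iff₀ hl] at h3
        have h4 := mul_le_mul_of_nonneg_left (hc' n) hl.le
        refine h4.trans ?_
        rw [mul_one_div, div_le_iff₀ hf]
        calc lam j = σ i₀ ^ n * ((σ i₀ ^ n)⁻¹ * lam j) := by field_simp
          _ ≤ _ := by gcongr
    choose N hN using hN
    refine ⟨fun j => Pi.single i₀ (Nat.pair (enc j) (N j)), fun j j' h => ?_, fun j _ => ?_⟩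
    · have := Pi.single_injective i₀ h
      exact henc (Nat.pair_eq_pair.1 this).1
    · rw [hdeg, hprod]
      exact hN j _ (Nat.right_le_pair _ _)
  -- One bad degree makes all degrees `n + 2 * l` bad, so there is room for every `j` at indices
  -- where nothing is required; zero eigenvalues do no harm here.
  · push Not at hall
    obtain ⟨n, hn⟩ := hall
    refine ⟨fun j => Pi.single i₀ (n + 2 * enc j), fun j j' h => ?_, fun j hj => ?_⟩
    · have := Pi.single_injective i₀ h
      exact henc (by omega)
    · rw [hdeg] at hj
      exact absurd hj (hbad n _ hn)

theorem exists_reindex_hilbertBasis {H J S : Type*} [NormedAddCommGroup H]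
    [InnerProductSpace ℝ H] [CompleteSpace H] (e : HilbertBasis J ℝ H) {h : S → J}
    (hh : Function.Bijective h) : ∃ e' : HilbertBasis S ℝ H, ∀ β, e' β = e (h β) := by
  have ho : Orthonormal ℝ (e ∘ h) := e.orthonormal.comp h hh.injective
  refine ⟨HilbertBasis.mk ho ?_, fun β => ?_⟩
  · rw [Set.range_comp, hh.surjective.range_eq, Set.image_univ, e.dense_span]
  · rw [HilbertBasis.coe_mk]
    rfl

/-! ### Hilbert–Schmidt integral operators on `L²`. -/

theorem eLpNorm_two_sq_eq_lintegral {X : Type*} [MeasurableSpace X] (μ : Measure X) (f : X → ℝ) :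
    eLpNorm f 2 μ ^ 2 = ∫⁻ x, ‖f x‖ₑ ^ 2 ∂μ := by
  have := eLpNorm_nnreal_pow_eq_lintegral (μ := μ) (f := f) (p := 2) two_ne_zero
  simpa using this

theorem lintegral_mul_sq_le {X : Type*} [MeasurableSpace X] (μ : Measure X) {f g : X → ℝ}
    (hf : AEStronglyMeasurable f μ) (hg : AEStronglyMeasurable g μ) :
    (∫⁻ x, ‖f x‖ₑ * ‖g x‖ₑ ∂μ) ^ 2 ≤ (∫⁻ x, ‖f x‖ₑ ^ 2 ∂μ) * ∫⁻ x, ‖g x‖ₑ ^ 2 ∂μ := by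
  have h := ENNReal.lintegral_mul_le_Lp_mul_Lq μ Real.HolderConjugate.two_two hf.enorm hg.enorm
  simp only [Pi.mul_apply, ENNReal.rpow_two] at h
  refine (pow_le_pow_left₀ zero_le h 2).trans (le_of_eq ?_)
  rw [mul_pow, ← ENNReal.rpow_two, ← ENNReal.rpow_two, ← ENNReal.rpow_mul, ← ENNReal.rpow_mul]
  norm_num

theorem IsHilbertSchmidtKernel.sub {X : Type*} [MeasurableSpace X] {μ : Measure X}
    {k k' : X → X → ℝ}
    (hk : IsHilbertSchmidtKernel k μ) (hk' : IsHilbertSchmidtKernel k' μ) :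
    IsHilbertSchmidtKernel (fun x y => k x y - k' x y) μ :=
  MemLp.sub hk hk'

section IntegralOperator

variable {X : Type*} [MeasurableSpace X] {μ : Measure X} [SFinite μ]

theorem aestronglyMeasurable_integralOperator {k : X → X → ℝ} (hk : IsHilbertSchmidtKernel k μ)
    {f : X → ℝ} (hf : MemLp f 2 μ) : AEStronglyMeasurable (integralOperator k μ f) μ :=
  (hk.1.mul (hf.1.comp_snd (μ := μ))).integral_prod_right'

theorem eLpNorm_integralOperator_le {k : X → X → ℝ} (hk : IsHilbertSchmidtKernel k μ)
    {f : X → ℝ} (hf : MemLp f 2 μ) :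
    eLpNorm (integralOperator k μ f) 2 μ
      ≤ eLpNorm (fun p : X × X => k p.1 p.2) 2 (μ.prod μ) * eLpNorm f 2 μ := by
  rw [← ENNReal.pow_le_pow_left_iff two_ne_zero, mul_pow, eLpNorm_two_sq_eq_lintegral,
    eLpNorm_two_sq_eq_lintegral, eLpNorm_two_sq_eq_lintegral, lintegral_prod _ (by
      exact hk.1.enorm.pow_const 2), ← lintegral_mul_const'' _ (by
      exact (hk.1.enorm.pow_const 2).lintegral_prod_right')]
  refine lintegral_mono_ae ?_
  filter_upwards [hk.1.prodMk_left] with x hx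
  refine le_trans ?_ (lintegral_mul_sq_le μ hx hf.1)
  gcongr
  refine (enorm_integral_le_lintegral_enorm _).trans (le_of_eq ?_)
  simp [enorm_mul]

theorem IsHilbertSchmidtKernel.ae_memLp {k : X → X → ℝ} (hk : IsHilbertSchmidtKernel k μ) :
    ∀ᵐ x ∂μ, MemLp (k x) 2 μ := by
  filter_upwards [hk.1.prodMk_left, (MemLp.integrable_sq hk).prod_right_ae] with x h1 h2
  exact (memLp_two_iff_integrable_sq h1).2 h2

theorem memLp_integralOperator {k : X → X → ℝ} (hk : IsHilbertSchmidtKernel k μ)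
    {f : X → ℝ} (hf : MemLp f 2 μ) : MemLp (integralOperator k μ f) 2 μ :=
  ⟨aestronglyMeasurable_integralOperator hk hf,
    (eLpNorm_integralOperator_le hk hf).trans_lt (ENNReal.mul_lt_top hk.2 hf.2)⟩

theorem exists_clm_integralOperator {k : X → X → ℝ} (hk : IsHilbertSchmidtKernel k μ) :
    ∃ T : Lp ℝ 2 μ →L[ℝ] Lp ℝ 2 μ, ∀ f : Lp ℝ 2 μ, T f =ᵐ[μ] integralOperator k μ f := by
  let T₀ : Lp ℝ 2 μ →ₗ[ℝ] Lp ℝ 2 μ :=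
    { toFun := fun f => (memLp_integralOperator hk (Lp.memLp f)).toLp _
      map_add' := fun f g => by
        ext1
        refine (MemLp.coeFn_toLp _).trans ?_
        refine .trans ?_ (Lp.coeFn_add _ _).symm
        filter_upwards [MemLp.coeFn_toLp (memLp_integralOperator hk (Lp.memLp f)),
          MemLp.coeFn_toLp (memLp_integralOperator hk (Lp.memLp g)), hk.ae_memLp] with x h1 h2 h3
        rw [Pi.add_apply, h1, h2]
        simp only [integralOperator]
        rw [← integral_add]
        · refine integral_congr_ae ?_
          filter_upwards [Lp.coeFn_add f g] with y hy
          rw [hy, Pi.add_apply, mul_add]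
        · exact h3.integrable_mul (Lp.memLp f)
        · exact h3.integrable_mul (Lp.memLp g)
      map_smul' := fun c f => by
        ext1
        refine (MemLp.coeFn_toLp _).trans ?_
        refine .trans ?_ (Lp.coeFn_smul _ _).symm
        filter_upwards [MemLp.coeFn_toLp (memLp_integralOperator hk (Lp.memLp f))] with x h1
        rw [RingHom.id_apply, Pi.smul_apply, h1]
        simp only [integralOperator, smul_eq_mul]
        rw [← integral_const_mul]
        refine integral_congr_ae ?_
        filter_upwards [Lp.coeFn_smul c f] with y hy
        rw [hy, Pi.smul_apply, smul_eq_mul]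
        ring }
  refine ⟨T₀.mkContinuous (eLpNorm (fun p : X × X => k p.1 p.2) 2 (μ.prod μ)).toReal fun f => ?_,
    fun f => MemLp.coeFn_toLp (memLp_integralOperator hk (Lp.memLp f))⟩
  change ‖(memLp_integralOperator hk (Lp.memLp f)).toLp _‖ ≤ _
  rw [Lp.norm_toLp, Lp.norm_def, ← ENNReal.toReal_mul]
  exact ENNReal.toReal_mono (ENNReal.mul_ne_top hk.2.ne (Lp.memLp f).2.ne)
    (eLpNorm_integralOperator_le hk (Lp.memLp f))

theorem norm_sub_le_of_integralOperator {k k' : X → X → ℝ} (hk : IsHilbertSchmidtKernel k μ)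
    (hk' : IsHilbertSchmidtKernel k' μ) {T T' : Lp ℝ 2 μ →L[ℝ] Lp ℝ 2 μ}
    (hT : ∀ f : Lp ℝ 2 μ, T f =ᵐ[μ] integralOperator k μ f)
    (hT' : ∀ f : Lp ℝ 2 μ, T' f =ᵐ[μ] integralOperator k' μ f) :
    ‖T - T'‖ ≤ (eLpNorm (fun p : X × X => k p.1 p.2 - k' p.1 p.2) 2 (μ.prod μ)).toReal := by
  refine ContinuousLinearMap.opNorm_le_bound _ ENNReal.toReal_nonneg fun f => ?_
  have hks := hk.sub hk'
  have h : (T - T') f =ᵐ[μ] integralOperator (fun x y => k x y - k' x y) μ f := by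
    rw [sub_apply]
    refine (Lp.coeFn_sub _ _).trans ?_
    filter_upwards [hT f, hT' f, hk.ae_memLp, hk'.ae_memLp] with x h1 h2 h3 h4
    rw [Pi.sub_apply, h1, h2]
    simp only [integralOperator, sub_mul]
    rw [integral_sub]
    · exact h3.integrable_mul (Lp.memLp f)
    · exact h4.integrable_mul (Lp.memLp f)
  rw [Lp.norm_def, Lp.norm_def, ← ENNReal.toReal_mul, eLpNorm_congr_ae h]
  exact ENNReal.toReal_mono (ENNReal.mul_ne_top hks.2.ne (Lp.memLp f).2.ne)
    (eLpNorm_integralOperator_le hks (Lp.memLp f))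

/-- A Hilbert-Schmidt kernel that is an `L²` limit of the partial sums of
`∑ i, c i * φ i x * φ i y` induces a compact symmetric operator whose quadratic form is
`∑ i, c i * ⟪φ i, f⟫ ^ 2`. -/
theorem exists_isCompactOperator_integralOperator {ι : Type*} {k : X → X → ℝ}
    (hk : IsHilbertSchmidtKernel k μ) {φ : ι → X → ℝ} (hφ : ∀ i, MemLp (φ i) 2 μ) (c : ι → ℝ)
    (I : ℕ → Finset ι)
    (hlim : Filter.Tendsto (fun N => eLpNorm (fun p : X × X => k p.1 p.2
      - ∑ i ∈ I N, c i * (φ i p.1 * φ i p.2)) 2 (μ.prod μ)) Filter.atTop (nhds 0)) :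
    ∃ T : Lp ℝ 2 μ →L[ℝ] Lp ℝ 2 μ, (∀ f : Lp ℝ 2 μ, T f =ᵐ[μ] integralOperator k μ f) ∧
      IsCompactOperator T ∧ (T : Lp ℝ 2 μ →ₗ[ℝ] Lp ℝ 2 μ).IsSymmetric ∧
      ∀ f, Filter.Tendsto (fun N => ∑ i ∈ I N, c i * (inner ℝ ((hφ i).toLp (φ i)) f) ^ 2)
        Filter.atTop (nhds (inner ℝ (T f) f)) := by
  obtain ⟨T, hT⟩ := exists_clm_integralOperator hk
  set ψ : ι → Lp ℝ 2 μ := fun i => (hφ i).toLp (φ i) with hψ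
  let F : ℕ → Lp ℝ 2 μ →L[ℝ] Lp ℝ 2 μ := fun N =>
    ∑ i ∈ I N, c i • InnerProductSpace.rankOne ℝ (ψ i) (ψ i)
  have hprod (i : ι) : IsHilbertSchmidtKernel (fun x y => φ i x * φ i y) μ := by
    refine ⟨((hφ i).1.comp_fst).mul ((hφ i).1.comp_snd), ?_⟩
    have h : eLpNorm (fun p : X × X => φ i p.1 * φ i p.2) 2 (μ.prod μ) ^ 2 < ⊤ := by
      rw [eLpNorm_two_sq_eq_lintegral, lintegral_prod _ (by
        exact (((hφ i).1.comp_fst).mul ((hφ i).1.comp_snd)).enorm.pow_const 2)]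
      simp only [enorm_mul, mul_pow]
      simp_rw [lintegral_const_mul'' _ ((hφ i).1.enorm.pow_const 2)]
      rw [lintegral_mul_const'' _ ((hφ i).1.enorm.pow_const 2), ← eLpNorm_two_sq_eq_lintegral]
      exact ENNReal.mul_lt_top (ENNReal.pow_lt_top (hφ i).2) (ENNReal.pow_lt_top (hφ i).2)
    by_contra h'
    rw [not_lt, top_le_iff] at h'
    rw [h'] at h
    simp at h
  have hkN (N : ℕ) : IsHilbertSchmidtKernel (fun x y => ∑ i ∈ I N, c i * (φ i x * φ i y)) μ := by
    refine memLp_finsetSum _ fun i _ => ?_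
    exact MemLp.const_mul (hprod i) (c i)
  have hF (N : ℕ) (f : Lp ℝ 2 μ) : F N f =ᵐ[μ]
      integralOperator (fun x y => ∑ i ∈ I N, c i * (φ i x * φ i y)) μ f := by
    have h1 : F N f = ∑ i ∈ I N, (c i * inner ℝ (ψ i) f) • ψ i := by
      simp [F, smul_smul]
    rw [h1]
    refine (Lp.coeFn_finsetSum _ _).trans ?_
    have h2 : ∀ᵐ x ∂μ, ∀ i ∈ I N, ((c i * inner ℝ (ψ i) f) • ψ i : Lp ℝ 2 μ) x
        = (c i * inner ℝ (ψ i) f) * φ i x := by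
      refine (ae_ball_iff (I N).countable_toSet).2 fun i _ => ?_
      filter_upwards [Lp.coeFn_smul (c i * inner ℝ (ψ i) f) (ψ i), (hφ i).coeFn_toLp] with x h3 h4
      rw [h3, Pi.smul_apply, smul_eq_mul, h4]
    filter_upwards [h2] with x hx
    rw [Finset.sum_apply, Finset.sum_congr rfl hx]
    simp only [integralOperator, Finset.sum_mul]
    rw [integral_finsetSum]
    · refine Finset.sum_congr rfl fun i _ => ?_
      rw [L2.inner_def, mul_assoc, mul_comm _ (φ i x), ← mul_assoc, ← integral_const_mul]
      refine integral_congr_ae ?_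
      filter_upwards [(hφ i).coeFn_toLp] with y hy
      simp only [hψ, hy, RCLike.inner_apply, conj_trivial]
      ring
    · intro i _
      have := ((hφ i).integrable_mul (Lp.memLp f)).const_mul (c i * φ i x)
      refine this.congr (.of_forall fun y => ?_)
      simp only [Pi.mul_apply]
      ring
  -- The `L²` norm of a kernel dominates the operator norm, so the finite-rank truncations converge
  -- in norm. Compactness, symmetry and the form all pass to the limit.
  have hFT : Filter.Tendsto F Filter.atTop (nhds T) := by
    rw [tendsto_iff_norm_sub_tendsto_zero]
    have h1 := (ENNReal.tendsto_toReal ENNReal.zero_ne_top).comp hlim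
    refine squeeze_zero (fun _ => norm_nonneg _) (fun N => ?_) h1
    rw [norm_sub_rev]
    exact norm_sub_le_of_integralOperator hk (hkN N) hT (hF N)
  have hform (N : ℕ) (f g : Lp ℝ 2 μ) :
      inner ℝ (F N f) g = ∑ i ∈ I N, c i * (inner ℝ (ψ i) f * inner ℝ (ψ i) g) := by
    simp [F, sum_inner, inner_smul_left]
  have hinner (f g : Lp ℝ 2 μ) :
      Filter.Tendsto (fun N => inner ℝ (F N f) g) Filter.atTop (nhds (inner ℝ (T f) g)) := by
    have h1 : Filter.Tendsto (fun N => F N f) Filter.atTop (nhds (T f)) :=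
      ((ContinuousLinearMap.apply ℝ (Lp ℝ 2 μ) f).continuous.tendsto T).comp hFT
    exact h1.inner tendsto_const_nhds
  refine ⟨T, hT, ?_, ?_, fun f => ?_⟩
  · refine isCompactOperator_of_tendsto hFT (.of_forall fun N => ?_)
    have : F N ∈ compactOperator (RingHom.id ℝ) (Lp ℝ 2 μ) (Lp ℝ 2 μ) := by
      refine Submodule.sum_mem _ fun i _ => Submodule.smul_mem _ _ ?_
      have h1 : IsCompactOperator (innerSL ℝ (ψ i)) := isCompactOperator_of_locallyCompactSpace_dom (innerSL ℝ (ψ i))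
      exact h1.clm_comp (ContinuousLinearMap.toSpanSingleton ℝ (ψ i))
    exact this
  · intro f g
    have h1 := hinner f g
    have h2 := hinner g f
    simp only [hform] at h1 h2
    simp only [mul_comm (inner ℝ (ψ _) g)] at h2
    have := tendsto_nhds_unique h1 h2
    rw [real_inner_comm f (T g)] at this
    exact this
  · have := hinner f f
    simpa only [hform, ← sq] using this

end IntegralOperator

/-! ### One-dimensional Gaussian moments and Hermite polynomials. -/

theorem integrable_pow_gaussianReal (v : ℝ≥0) (n : ℕ) :
    Integrable (fun x : ℝ => x ^ n) (gaussianReal 0 v) :=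
  integrable_pow_of_mem_interior_integrableExpSet (X := id) (by simp) n

theorem integrable_pow_mul_gaussianPDFReal {v : ℝ≥0} (hv : v ≠ 0) (n : ℕ) :
    Integrable (fun x : ℝ => x ^ n * gaussianPDFReal 0 v x) := by
  have hv' : (0 : ℝ) < v := by positivity
  have h := (integrable_rpow_mul_exp_neg_mul_sq (b := (2 * (v : ℝ))⁻¹) (by positivity)
    (s := n) (by linarith [n.cast_nonneg (α := ℝ)])).const_mul (√(2 * Real.pi * v))⁻¹
  refine h.congr (.of_forall fun x => ?_)
  simp only [gaussianPDFReal, Real.rpow_natCast, sub_zero]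
  rw [neg_div, div_eq_inv_mul, neg_mul]
  ring

theorem hasDerivAt_gaussianPDFReal {v : ℝ≥0} (hv : v ≠ 0) (x : ℝ) :
    HasDerivAt (fun x => -((v : ℝ) * gaussianPDFReal 0 v x)) (x * gaussianPDFReal 0 v x) x := by
  have hv' : (v : ℝ) ≠ 0 := by simpa using hv
  have h1 : HasDerivAt (fun x : ℝ => -(x - 0) ^ 2 / (2 * (v : ℝ))) (-(2 * x) / (2 * v)) x := by
    have := (((hasDerivAt_id x).sub_const 0).pow 2).neg.div_const (2 * (v : ℝ))
    simpa using this
  have h2 := ((h1.exp.const_mul (√(2 * Real.pi * v))⁻¹).const_mul (v : ℝ)).neg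
  refine h2.congr_deriv ?_
  simp only [gaussianPDFReal]
  field_simp

/-- Gaussian integration by parts: `x` times the density is the derivative of `-v` times the
density. -/
theorem integral_pow_add_two_gaussianReal {v : ℝ≥0} (hv : v ≠ 0) (n : ℕ) :
    ∫ x, x ^ (n + 2) ∂gaussianReal 0 v = v * (n + 1) * ∫ x, x ^ n ∂gaussianReal 0 v := by
  simp only [integral_gaussianReal_eq_integral_smul hv, smul_eq_mul]
  have h := integral_mul_deriv_eq_deriv_mul_of_integrable
    (u := fun x : ℝ => x ^ (n + 1)) (u' := fun x => ((n + 1 : ℕ) : ℝ) * x ^ n)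
    (v := fun x => -((v : ℝ) * gaussianPDFReal 0 v x)) (v' := fun x => x * gaussianPDFReal 0 v x)
    (fun x _ => by simpa using hasDerivAt_pow (n + 1) x)
    (fun x _ => hasDerivAt_gaussianPDFReal hv x) ?_ ?_ ?_
  · rw [← integral_neg] at h
    calc _ = ∫ x, x ^ (n + 1) * (x * gaussianPDFReal 0 v x) := by
          refine integral_congr_ae (.of_forall fun x => ?_)
          simp only
          ring
      _ = _ := h
      _ = _ := by
          rw [← integral_const_mul]
          refine integral_congr_ae (.of_forall fun x => ?_)
          simp only
          push_cast
          ring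
  · refine (integrable_pow_mul_gaussianPDFReal hv (n + 2)).congr (.of_forall fun x => ?_)
    simp only [Pi.mul_apply]
    ring
  · refine ((integrable_pow_mul_gaussianPDFReal hv n).const_mul (-(v * ((n + 1 : ℕ) : ℝ)))).congr
      (.of_forall fun x => ?_)
    simp only [Pi.mul_apply]
    ring
  · refine ((integrable_pow_mul_gaussianPDFReal hv (n + 1)).const_mul (-(v : ℝ))).congr
      (.of_forall fun x => ?_)
    simp only [Pi.mul_apply]
    ring

theorem integral_pow_gaussianReal_even {v : ℝ≥0} (hv : v ≠ 0) (k : ℕ) :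
    ∫ x, x ^ (2 * k) ∂gaussianReal 0 v
      = v ^ k * (2 * k).factorial / (2 ^ k * k.factorial) := by
  induction k with
  | zero => simp
  | succ k ih =>
    rw [mul_add, mul_one, integral_pow_add_two_gaussianReal hv, ih, Nat.factorial_succ (2 * k + 1),
      Nat.factorial_succ (2 * k), Nat.factorial_succ k]
    push_cast
    field_simp
    ring

theorem integral_pow_gaussianReal_odd {v : ℝ≥0} (hv : v ≠ 0) (k : ℕ) :
    ∫ x, x ^ (2 * k + 1) ∂gaussianReal 0 v = 0 := by
  induction k with
  | zero => simp [integral_id_gaussianReal]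
  | succ k ih =>
    have : 2 * (k + 1) + 1 = 2 * k + 1 + 2 := by ring
    rw [this, integral_pow_add_two_gaussianReal hv, ih, mul_zero]

/-- The monic Hermite polynomials for the centred Gaussian measure of variance `v`. -/
noncomputable def gaussHermite (v : ℝ) : ℕ → ℝ → ℝ
  | 0, _ => 1
  | 1, x => x
  | n + 2, x => x * gaussHermite v (n + 1) x - v * (n + 1) * gaussHermite v n x

/-- By homogeneity the variance enters only through `v ^ k`. Coefficients independent of `v`, with
leading coefficient exactly `1`, are what keep later constants free of `σ` and `d`. -/
theorem exists_gaussHermite_eq_sum (n : ℕ) : ∃ c : ℕ → ℝ, c 0 = 1 ∧ ∀ v x : ℝ,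
    gaussHermite v n x = ∑ k ∈ Finset.range (n / 2 + 1), c k * v ^ k * x ^ (n - 2 * k) := by
  induction n using Nat.twoStepInduction with
  | zero => exact ⟨fun _ => 1, rfl, fun v x => by simp [gaussHermite]⟩
  | one => exact ⟨fun _ => 1, rfl, fun v x => by simp [gaussHermite]⟩
  | more n ih0 ih1 =>
    obtain ⟨c0, h00, h0⟩ := ih0
    obtain ⟨c1, h10, h1⟩ := ih1
    refine ⟨fun k => (if k ≤ (n + 1) / 2 then c1 k else 0)
      - (n + 1) * (if k = 0 then 0 else c0 (k - 1)), by simp [h10], fun v x => ?_⟩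
    rw [gaussHermite, h0, h1]
    have e1 : (n + 2) / 2 + 1 = (n / 2 + 1) + 1 := by omega
    simp only [sub_mul, Finset.sum_sub_distrib]
    congr 1
    · rw [Finset.mul_sum]
      have hsub : Finset.range ((n + 1) / 2 + 1) ⊆ Finset.range ((n + 2) / 2 + 1) := by
        intro k hk
        rw [Finset.mem_range] at hk ⊢
        omega
      rw [← Finset.sum_subset hsub]
      · refine Finset.sum_congr rfl fun k hk => ?_
        rw [Finset.mem_range] at hk
        have h2 : n + 2 - 2 * k = (n + 1 - 2 * k) + 1 := by omega
        rw [if_pos (by omega), h2, pow_succ]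
        ring
      · intro k _ hk
        rw [Finset.mem_range] at hk
        rw [if_neg (by omega)]
        simp
    · rw [e1, Finset.sum_range_succ' _ (n / 2 + 1), Finset.mul_sum]
      simp only [if_true, mul_zero, zero_mul, add_zero, Nat.add_one_ne_zero, if_false,
        Nat.add_sub_cancel]
      refine Finset.sum_congr rfl fun k _ => ?_
      have h2 : n + 2 - 2 * (k + 1) = n - 2 * k := by omega
      rw [h2, pow_succ]
      ring

theorem integrable_pow_mul_gaussHermite (v : ℝ≥0) (a b : ℕ) :
    Integrable (fun x : ℝ => x ^ a * gaussHermite v b x) (gaussianReal 0 v) := by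
  obtain ⟨c, -, hc⟩ := exists_gaussHermite_eq_sum b
  simp only [hc, Finset.mul_sum]
  refine integrable_finsetSum _ fun k _ => ?_
  refine ((integrable_pow_gaussianReal v (a + (b - 2 * k))).const_mul (c k * (v : ℝ) ^ k)).congr
    (.of_forall fun x => ?_)
  simp only
  ring

/-- Lowering both degrees by one reduces all mixed moments to pure moments. The recurrence transfers
the identity from smaller `b`, the base case being integration by parts. -/
theorem integral_pow_mul_gaussHermite_succ {v : ℝ≥0} (hv : v ≠ 0) (b : ℕ) :
    ∫ x, x ^ 0 * gaussHermite v (b + 1) x ∂gaussianReal 0 v = 0 ∧ ∀ a : ℕ,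
    ∫ x, x ^ (a + 1) * gaussHermite v (b + 1) x ∂gaussianReal 0 v
      = v * (a + 1) * ∫ x, x ^ a * gaussHermite v b x ∂gaussianReal 0 v := by
  have hrec (a b : ℕ) : ∫ x, x ^ a * gaussHermite v (b + 2) x ∂gaussianReal 0 v
      = ∫ x, x ^ (a + 1) * gaussHermite v (b + 1) x ∂gaussianReal 0 v
        - v * (b + 1) * ∫ x, x ^ a * gaussHermite v b x ∂gaussianReal 0 v := by
    rw [← integral_const_mul, ← integral_sub (integrable_pow_mul_gaussHermite v _ _)
      ((integrable_pow_mul_gaussHermite v _ _).const_mul _)]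
    refine integral_congr_ae (.of_forall fun x => ?_)
    simp only [gaussHermite]
    ring
  induction b using Nat.strong_induction_on with
  | _ b ih =>
    rcases b with _ | b
    · refine ⟨by simp [gaussHermite], fun a => ?_⟩
      have := integral_pow_add_two_gaussianReal hv a
      simpa [gaussHermite, pow_succ, mul_assoc] using this
    · obtain ⟨i0, i1⟩ := ih b (by omega)
      refine ⟨?_, fun a => ?_⟩
      · rw [hrec, i1]
        rcases b with _ | b
        · simp
        · rw [(ih b (by omega)).1]
          simp
      · rw [hrec, i1]
        rcases b with _ | b
        · simp only [gaussHermite, pow_succ, mul_one]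
          push_cast
          ring
        · rw [hrec a b, (ih b (by omega)).2 a]
          push_cast
          ring

theorem integral_pow_mul_gaussHermite {v : ℝ≥0} (hv : v ≠ 0) (b k : ℕ) :
    ∫ x, x ^ (b + 2 * k) * gaussHermite v b x ∂gaussianReal 0 v
      = v ^ (b + k) * (b + 2 * k).factorial / (2 ^ k * k.factorial) := by
  induction b with
  | zero => simpa [gaussHermite] using integral_pow_gaussianReal_even hv k
  | succ b ih =>
    have h1 : b + 1 + 2 * k = (b + 2 * k) + 1 := by ring
    have h2 : b + 1 + k = (b + k) + 1 := by ring
    rw [h1, h2, (integral_pow_mul_gaussHermite_succ hv b).2, ih, Nat.factorial_succ, pow_succ]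
    push_cast
    ring

theorem integral_pow_mul_gaussHermite_eq_zero {v : ℝ≥0} (hv : v ≠ 0) {a b : ℕ}
    (h : ∀ k, a ≠ b + 2 * k) : ∫ x, x ^ a * gaussHermite v b x ∂gaussianReal 0 v = 0 := by
  induction b generalizing a with
  | zero =>
    have : a = 2 * (a / 2) + 1 := by
      have := h (a / 2)
      omega
    simp only [gaussHermite, mul_one]
    rw [this]
    exact integral_pow_gaussianReal_odd hv _
  | succ b ih =>
    rcases a with _ | a
    · exact (integral_pow_mul_gaussHermite_succ hv b).1
    · rw [(integral_pow_mul_gaussHermite_succ hv b).2, ih, mul_zero]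
      intro k hk
      exact h k (by omega)

theorem integral_gaussHermite_mul {v : ℝ≥0} (hv : v ≠ 0) (a b : ℕ) :
    ∫ x, gaussHermite v a x * gaussHermite v b x ∂gaussianReal 0 v
      = if a = b then (v : ℝ) ^ b * b.factorial else 0 := by
  wlog hab : a ≤ b generalizing a b
  · simp only [mul_comm (gaussHermite v a _)]
    rw [this b a (by omega)]
    rcases eq_or_ne a b with rfl | h
    · simp
    · rw [if_neg h, if_neg h.symm]
  obtain ⟨c, hc0, hc⟩ := exists_gaussHermite_eq_sum a
  simp only [hc v, Finset.sum_mul]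
  rw [integral_finsetSum]
  · have hterm (k : ℕ) : ∫ x, c k * (v : ℝ) ^ k * x ^ (a - 2 * k) * gaussHermite v b x
        ∂gaussianReal 0 v
        = c k * (v : ℝ) ^ k * ∫ x, x ^ (a - 2 * k) * gaussHermite v b x ∂gaussianReal 0 v := by
      rw [← integral_const_mul]
      refine integral_congr_ae (.of_forall fun x => ?_)
      simp only
      ring
    simp only [hterm]
    rw [Finset.sum_eq_single 0]
    · split_ifs with h
      · subst h
        have := integral_pow_mul_gaussHermite hv a 0
        simp at this
        simp [hc0, this]
      · rw [integral_pow_mul_gaussHermite_eq_zero hv, mul_zero]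
        intro k hk
        omega
    · intro k hk hk0
      rw [Finset.mem_range] at hk
      rw [integral_pow_mul_gaussHermite_eq_zero hv, mul_zero]
      intro l hl
      omega
    · simp
  · intro k _
    refine ((integrable_pow_mul_gaussHermite v (a - 2 * k) b).const_mul (c k * (v : ℝ) ^ k)).congr
      (.of_forall fun x => ?_)
    simp only
    ring

/-! ### Monomials and Hermite products in `L²` of the product Gaussian. -/

section GaussianL2

variable {d : ℕ}

instance (σ : Fin d → ℝ≥0) : IsProbabilityMeasure (diagGaussian σ) := by
  unfold diagGaussian
  infer_instance

/-- The monomial `x ^ α`. -/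
def multiMonomial (α : Fin d → ℕ) (x : Fin d → ℝ) : ℝ := ∏ i, x i ^ α i

/-- The product of the one-dimensional Hermite polynomials. -/
noncomputable def multiHermite (σ : Fin d → ℝ≥0) (β : Fin d → ℕ) (x : Fin d → ℝ) : ℝ :=
  ∏ i, gaussHermite (σ i) (β i) (x i)

theorem measurable_multiMonomial (α : Fin d → ℕ) : Measurable (multiMonomial α) := by
  unfold multiMonomial
  fun_prop

theorem multiMonomial_mul (α α' : Fin d → ℕ) (x : Fin d → ℝ) :
    multiMonomial α x * multiMonomial α' x = multiMonomial (α + α') x := by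
  simp [multiMonomial, pow_add, Finset.prod_mul_distrib]

theorem integrable_multiMonomial (σ : Fin d → ℝ≥0) (α : Fin d → ℕ) :
    Integrable (multiMonomial α) (diagGaussian σ) :=
  Integrable.fintype_prod (f := fun i x => x ^ α i) fun i => integrable_pow_gaussianReal (σ i) (α i)

theorem memLp_multiMonomial (σ : Fin d → ℝ≥0) (α : Fin d → ℕ) :
    MemLp (multiMonomial α) 2 (diagGaussian σ) := by
  rw [memLp_two_iff_integrable_sq (measurable_multiMonomial α).aestronglyMeasurable]
  simp only [sq, multiMonomial_mul]
  exact integrable_multiMonomial σ _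

/-- The monomial `x ^ α` as an element of `L²`. -/
noncomputable def monomialLp (σ : Fin d → ℝ≥0) (α : Fin d → ℕ) : Lp ℝ 2 (diagGaussian σ) :=
  (memLp_multiMonomial σ α).toLp _

theorem exists_multiHermite_eq_sum : ∃ c : ℕ → ℕ → ℝ, (∀ n, c n 0 = 1) ∧
    ∀ {d : ℕ} (σ : Fin d → ℝ≥0) (β : Fin d → ℕ) (x : Fin d → ℝ), multiHermite σ β x =
      ∑ k ∈ Fintype.piFinset fun i => Finset.range (β i / 2 + 1),
        (∏ i, c (β i) (k i) * (σ i : ℝ) ^ k i) * multiMonomial (fun i => β i - 2 * k i) x := by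
  choose c h0 hc using exists_gaussHermite_eq_sum
  refine ⟨c, h0, fun σ β x => ?_⟩
  simp only [multiHermite, hc, Finset.prod_univ_sum, multiMonomial, ← Finset.prod_mul_distrib]

theorem memLp_multiHermite (σ : Fin d → ℝ≥0) (β : Fin d → ℕ) :
    MemLp (multiHermite σ β) 2 (diagGaussian σ) := by
  obtain ⟨c, -, hc⟩ := exists_multiHermite_eq_sum
  have : multiHermite σ β = fun x => ∑ k ∈ Fintype.piFinset fun i => Finset.range (β i / 2 + 1),
      (∏ i, c (β i) (k i) * (σ i : ℝ) ^ k i) * multiMonomial (fun i => β i - 2 * k i) x :=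
    funext fun x => hc σ β x
  rw [this]
  exact memLp_finsetSum _ fun k _ => (memLp_multiMonomial σ _).const_mul _

/-- The squared norm of a product Hermite polynomial. -/
noncomputable def hermiteNormSq (σ : Fin d → ℝ≥0) (β : Fin d → ℕ) : ℝ :=
  ∏ i, (σ i : ℝ) ^ β i * (β i).factorial

theorem hermiteNormSq_pos {σ : Fin d → ℝ≥0} (hσ : ∀ i, 0 < σ i) (β : Fin d → ℕ) :
    0 < hermiteNormSq σ β :=
  Finset.prod_pos fun i _ => by
    have : (0 : ℝ) < σ i := hσ i
    positivity

/-- The normalized product Hermite polynomials in `L²`. -/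
noncomputable def hermiteLp (σ : Fin d → ℝ≥0) (β : Fin d → ℕ) : Lp ℝ 2 (diagGaussian σ) :=
  (√(hermiteNormSq σ β))⁻¹ • (memLp_multiHermite σ β).toLp _

theorem inner_toLp {X : Type*} [MeasurableSpace X] {μ : Measure X} {f g : X → ℝ}
    (hf : MemLp f 2 μ) (hg : MemLp g 2 μ) :
    inner ℝ (hf.toLp f) (hg.toLp g) = ∫ x, f x * g x ∂μ := by
  rw [L2.inner_def]
  refine integral_congr_ae ?_
  filter_upwards [hf.coeFn_toLp, hg.coeFn_toLp] with x h1 h2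
  rw [h1, h2, RCLike.inner_apply, conj_trivial, mul_comm]

theorem inner_monomialLp_monomialLp (σ : Fin d → ℝ≥0) (α β : Fin d → ℕ) :
    inner ℝ (monomialLp σ α) (monomialLp σ β)
      = ∏ i, ∫ x, x ^ (α i + β i) ∂gaussianReal 0 (σ i) := by
  rw [monomialLp, monomialLp, inner_toLp]
  simp only [multiMonomial_mul]
  exact integral_fintype_prod_eq_prod (𝕜 := ℝ) (fun i x => x ^ (α i + β i))

theorem inner_monomialLp_hermiteLp (σ : Fin d → ℝ≥0) (α β : Fin d → ℕ) :
    inner ℝ (monomialLp σ α) (hermiteLp σ β) = (√(hermiteNormSq σ β))⁻¹ *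
      ∏ i, ∫ x, x ^ α i * gaussHermite (σ i) (β i) x ∂gaussianReal 0 (σ i) := by
  rw [monomialLp, hermiteLp, inner_smul_right, inner_toLp]
  congr 1
  simp only [multiMonomial, multiHermite, ← Finset.prod_mul_distrib]
  exact integral_fintype_prod_eq_prod (𝕜 := ℝ) (fun i x => x ^ α i * gaussHermite (σ i) (β i) x)

theorem orthonormal_hermiteLp {σ : Fin d → ℝ≥0} (hσ : ∀ i, 0 < σ i) :
    Orthonormal ℝ (hermiteLp σ) := by
  classical
  rw [orthonormal_iff_ite]
  intro α β
  have h : inner ℝ (hermiteLp σ α) (hermiteLp σ β) = (√(hermiteNormSq σ α))⁻¹ *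
      ((√(hermiteNormSq σ β))⁻¹ *
      ∏ i, ∫ x, gaussHermite (σ i) (α i) x * gaussHermite (σ i) (β i) x ∂gaussianReal 0 (σ i)) := by
    rw [hermiteLp, hermiteLp, inner_smul_right, inner_smul_left, inner_toLp, conj_trivial]
    simp only [multiHermite, ← Finset.prod_mul_distrib]
    rw [mul_left_comm]
    congr 2
    exact integral_fintype_prod_eq_prod (𝕜 := ℝ)
      (fun i x => gaussHermite (σ i) (α i) x * gaussHermite (σ i) (β i) x)
  rw [h]
  simp only [integral_gaussHermite_mul (hσ _).ne']
  split_ifs with hαβ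
  · subst hαβ
    simp only [if_true]
    change _ * (_ * hermiteNormSq σ α) = 1
    have := hermiteNormSq_pos hσ α
    rw [← mul_assoc, ← mul_inv, Real.mul_self_sqrt this.le, inv_mul_cancel₀ this.ne']
  · obtain ⟨i, hi⟩ := Function.ne_iff.1 hαβ
    rw [Finset.prod_eq_zero (Finset.mem_univ i) (if_neg hi)]
    simp

theorem exists_inner_hermiteLp_eq_sum : ∃ c : ℕ → ℕ → ℝ, (∀ n, c n 0 = 1) ∧
    ∀ {d : ℕ} (σ : Fin d → ℝ≥0) (β : Fin d → ℕ) (f : Lp ℝ 2 (diagGaussian σ)),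
      inner ℝ (hermiteLp σ β) f = (√(hermiteNormSq σ β))⁻¹ *
      ∑ k ∈ Fintype.piFinset fun i => Finset.range (β i / 2 + 1),
        (∏ i, c (β i) (k i) * (σ i : ℝ) ^ k i) *
          inner ℝ (monomialLp σ fun i => β i - 2 * k i) f := by
  obtain ⟨c, h0, hc⟩ := exists_multiHermite_eq_sum
  refine ⟨c, h0, fun {d} σ β f => ?_⟩
  rw [hermiteLp, inner_smul_left, conj_trivial]
  congr 1
  have : (memLp_multiHermite σ β).toLp _ =
      ∑ k ∈ Fintype.piFinset fun i => Finset.range (β i / 2 + 1),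
        (∏ i, c (β i) (k i) * (σ i : ℝ) ^ k i) • monomialLp σ fun i => β i - 2 * k i := by
    ext1
    refine (MemLp.coeFn_toLp _).trans (.trans ?_ (Lp.coeFn_finsetSum _ _).symm)
    have h2 : ∀ᵐ x ∂diagGaussian σ, ∀ k : Fin d → ℕ,
        ((∏ i, c (β i) (k i) * (σ i : ℝ) ^ k i) • monomialLp σ fun i => β i - 2 * k i :
          Lp ℝ 2 (diagGaussian σ)) x
        = (∏ i, c (β i) (k i) * (σ i : ℝ) ^ k i) * multiMonomial (fun i => β i - 2 * k i) x := by
      rw [ae_all_iff]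
      intro k
      filter_upwards [Lp.coeFn_smul (∏ i, c (β i) (k i) * (σ i : ℝ) ^ k i)
        (monomialLp σ fun i => β i - 2 * k i),
        (memLp_multiMonomial σ fun i => β i - 2 * k i).coeFn_toLp] with x h3 h4
      rw [h3, Pi.smul_apply, smul_eq_mul, monomialLp, h4]
    filter_upwards [h2] with x hx
    rw [Finset.sum_apply, Finset.sum_congr rfl fun k _ => hx k, hc]
  rw [this, sum_inner]
  refine Finset.sum_congr rfl fun k _ => ?_
  rw [inner_smul_left, conj_trivial]

end GaussianL2

/-! ### Lower bound for the form. -/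

/-- The sum factorizes, and each factor is `1 + O(σ i) ≤ exp (D * σ i)`. The exponents add up to at
most `D * τ` in any dimension. -/
theorem sum_box_prod_pow_le {d : ℕ} {σ : Fin d → ℝ} (hσ : ∀ i, 0 ≤ σ i) {τ : ℝ}
    (hτ : ∑ i, σ i ≤ τ) (n : ℕ) :
    ∑ k ∈ Fintype.piFinset fun _ : Fin d => Finset.range (n + 1), ∏ i, σ i ^ k i
      ≤ Real.exp ((∑ j ∈ Finset.range n, τ ^ j) * τ) := by
  have hτ0 : 0 ≤ τ := (Finset.sum_nonneg fun i _ => hσ i).trans hτ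
  set D := ∑ j ∈ Finset.range n, τ ^ j
  have hD : 0 ≤ D := Finset.sum_nonneg fun j _ => pow_nonneg hτ0 j
  rw [← Finset.prod_univ_sum (fun _ : Fin d => Finset.range (n + 1)) (fun i j => σ i ^ j)]
  calc ∏ i, ∑ j ∈ Finset.range (n + 1), σ i ^ j ≤ ∏ i, Real.exp (D * σ i) := by
        refine Finset.prod_le_prod (fun i _ => Finset.sum_nonneg fun j _ => pow_nonneg (hσ i) j)
          fun i _ => ?_
        have hi : σ i ≤ τ :=
          (Finset.single_le_sum (fun j _ => hσ j) (Finset.mem_univ i)).trans hτ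
        refine le_trans ?_ (Real.add_one_le_exp _)
        rw [Finset.sum_range_succ', pow_zero, Finset.sum_mul]
        gcongr with j _
        rw [pow_succ]
        have := hσ i
        gcongr
    _ = Real.exp (D * ∑ i, σ i) := by rw [← Real.exp_sum, Finset.mul_sum]
    _ ≤ _ := by gcongr

/-- The multi-indices `α` with `|α| ≤ n` and `|α| ≡ n` modulo `2`. -/
def parityIndices (d n : ℕ) : Finset (Fin d → ℕ) :=
  {α ∈ Fintype.piFinset fun _ => Finset.range (n + 1) | ∑ i, α i ≤ n ∧ ∑ i, α i ≡ n [MOD 2]}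

/-- Lower bound for the form: the Hermite coefficients of degree `n` of `f` are controlled by its
moments of degree at most `n` and of the same parity. -/
theorem exists_sum_inner_hermiteLp_sq_le (τ : ℝ) (n : ℕ) : ∃ L : ℝ, 0 ≤ L ∧
    ∀ {d : ℕ} {σ : Fin d → ℝ≥0}, (∀ i, 0 < σ i) → ∑ i, (σ i : ℝ) ≤ τ →
      ∀ B : Finset (Fin d → ℕ), (∀ β ∈ B, ∑ i, β i = n) → ∀ f : Lp ℝ 2 (diagGaussian σ),
        ∑ β ∈ B, (∏ i, (σ i : ℝ) ^ β i) * (inner ℝ (hermiteLp σ β) f) ^ 2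
          ≤ L * ∑ α ∈ parityIndices d n, (inner ℝ (monomialLp σ α) f) ^ 2 := by
  classical
  obtain ⟨c, hc0, hc⟩ := exists_inner_hermiteLp_eq_sum
  set Q : ℝ := 1 + ∑ b ∈ Finset.range (n + 1), ∑ k ∈ Finset.range (n + 1), |c b k|
  have hQ1 : 1 ≤ Q := by
    have : 0 ≤ ∑ b ∈ Finset.range (n + 1), ∑ k ∈ Finset.range (n + 1), |c b k| := by positivity
    linarith
  have hQ (b k : ℕ) (hb : b ≤ n) (hk : k ≤ n) : |c b k| ≤ Q := by
    have h1 : |c b k| ≤ ∑ k ∈ Finset.range (n + 1), |c b k| :=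
      Finset.single_le_sum (f := fun k => |c b k|) (fun _ _ => abs_nonneg _)
        (Finset.mem_range.2 (Nat.lt_succ_of_le hk))
    have h2 : ∑ k ∈ Finset.range (n + 1), |c b k|
        ≤ ∑ b ∈ Finset.range (n + 1), ∑ k ∈ Finset.range (n + 1), |c b k| :=
      Finset.single_le_sum (f := fun b => ∑ k ∈ Finset.range (n + 1), |c b k|)
        (fun _ _ => by positivity) (Finset.mem_range.2 (Nat.lt_succ_of_le hb))
    linarith
  set E := Real.exp ((∑ j ∈ Finset.range n, τ ^ j) * τ)
  refine ⟨E * (Q ^ n) ^ 2 * E, by positivity, fun {d σ} hσ hτ B hB f => ?_⟩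
  have hσ' (i : Fin d) : (0 : ℝ) < σ i := hσ i
  set P := Fintype.piFinset fun _ : Fin d => Finset.range (n + 1)
  have hE : ∑ k ∈ P, ∏ i, (σ i : ℝ) ^ k i ≤ E :=
    sum_box_prod_pow_le (fun i => (hσ' i).le) hτ n
  set Pβ : (Fin d → ℕ) → Finset (Fin d → ℕ) := fun β =>
    Fintype.piFinset fun i => Finset.range (β i / 2 + 1) with hPβ
  set F : (Fin d → ℕ) → ℝ := fun α => inner ℝ (monomialLp σ α) f with hF
  have hle (β) (hβ : β ∈ B) (i : Fin d) : β i ≤ n := by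
    rw [← hB β hβ]
    exact Finset.single_le_sum (f := β) (fun _ _ => Nat.zero_le _) (Finset.mem_univ i)
  have hk2 (β k : Fin d → ℕ) (hk : k ∈ Pβ β) (i : Fin d) : 2 * k i ≤ β i := by
    have := Finset.mem_range.1 (Fintype.mem_piFinset.1 hk i)
    omega
  have hsub (β) (hβ : β ∈ B) : Pβ β ⊆ P := by
    intro k hk
    refine Fintype.mem_piFinset.2 fun i => Finset.mem_range.2 ?_
    have := hk2 β k hk i
    have := hle β hβ i
    omega
  have hone (β) (hβ : β ∈ B) : (∏ i, (σ i : ℝ) ^ β i) * (inner ℝ (hermiteLp σ β) f) ^ 2 ≤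
      E * (Q ^ n) ^ 2 * ∑ k ∈ Pβ β, (∏ i, (σ i : ℝ) ^ k i) * F (fun i => β i - 2 * k i) ^ 2 := by
    have hN := hermiteNormSq_pos hσ β
    -- Coordinates with `β i = 0` contribute exactly `1`, so the bound is `Q ^ n` rather than `Q ^
    -- d`.
    have hγ (k) (hk : k ∈ Pβ β) : (∏ i, c (β i) (k i)) ^ 2 ≤ (Q ^ n) ^ 2 := by
      rw [← sq_abs, Finset.abs_prod]
      gcongr
      rw [← hB β hβ, ← Finset.prod_pow_eq_pow_sum]
      refine Finset.prod_le_prod (fun _ _ => abs_nonneg _) fun i _ => ?_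
      rcases Nat.eq_zero_or_pos (β i) with h | h
      · have : k i = 0 := by
          have := hk2 β k hk i
          omega
        simp [h, this, hc0]
      · refine (hQ _ _ (hle β hβ i) ?_).trans (le_self_pow₀ hQ1 h.ne')
        have := hk2 β k hk i
        have := hle β hβ i
        omega
    have hcs : (∑ k ∈ Pβ β, (∏ i, c (β i) (k i) * (σ i : ℝ) ^ k i) *
        F (fun i => β i - 2 * k i)) ^ 2 ≤ (∑ k ∈ Pβ β, ∏ i, (σ i : ℝ) ^ k i) *
        ∑ k ∈ Pβ β, (Q ^ n) ^ 2 * ((∏ i, (σ i : ℝ) ^ k i) * F (fun i => β i - 2 * k i) ^ 2) := by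
      refine Finset.sum_sq_le_sum_mul_sum_of_sq_le_mul _ (fun k _ => by positivity)
        (fun k _ => by positivity) fun k hk => ?_
      rw [Finset.prod_mul_distrib]
      calc _ = (∏ i, c (β i) (k i)) ^ 2 * ((∏ i, (σ i : ℝ) ^ k i) ^ 2 *
            F (fun i => β i - 2 * k i) ^ 2) := by ring
        _ ≤ (Q ^ n) ^ 2 * ((∏ i, (σ i : ℝ) ^ k i) ^ 2 * F (fun i => β i - 2 * k i) ^ 2) := by
            exact mul_le_mul_of_nonneg_right (hγ k hk) (by positivity)
        _ = _ := by ring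
    rw [hc, mul_pow, inv_pow, Real.sq_sqrt hN.le, ← mul_assoc]
    -- The weight cancels the squared Hermite norm up to the factor `1 / ∏ (β i)!`.
    have hfac : (∏ i, (σ i : ℝ) ^ β i) * (hermiteNormSq σ β)⁻¹ ≤ 1 := by
      rw [← div_eq_mul_inv]
      refine div_le_one_of_le₀ ?_ hN.le
      refine Finset.prod_le_prod (fun i _ => by positivity) fun i _ => ?_
      refine le_mul_of_one_le_right (by positivity) ?_
      exact_mod_cast Nat.one_le_iff_ne_zero.2 (Nat.factorial_ne_zero _)
    refine (mul_le_of_le_one_left (sq_nonneg _) hfac).trans (hcs.trans ?_)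
    rw [← Finset.mul_sum, ← mul_assoc]
    gcongr
    exact (Finset.sum_le_sum_of_subset_of_nonneg (hsub β hβ) fun _ _ _ => by positivity).trans hE
  calc _ ≤ ∑ β ∈ B, E * (Q ^ n) ^ 2 *
        ∑ k ∈ Pβ β, (∏ i, (σ i : ℝ) ^ k i) * F (fun i => β i - 2 * k i) ^ 2 :=
        Finset.sum_le_sum hone
    _ = E * (Q ^ n) ^ 2 * ∑ p ∈ B.sigma Pβ,
          (∏ i, (σ i : ℝ) ^ p.2 i) * F (fun i => p.1 i - 2 * p.2 i) ^ 2 := by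
        rw [← Finset.mul_sum, Finset.sum_sigma]
    -- The substitution `(β, k) ↦ (β - 2 k, k)` is injective because `2 k ≤ β`. It decouples the
    -- moment index from `k`, whose sum costs a second factor `E`.
    _ = E * (Q ^ n) ^ 2 * ∑ p ∈ (B.sigma Pβ).image
          (fun p => ((fun i => p.1 i - 2 * p.2 i, p.2) : (Fin d → ℕ) × (Fin d → ℕ))),
          (∏ i, (σ i : ℝ) ^ p.2 i) * F p.1 ^ 2 := by
        rw [Finset.sum_image]
        rintro ⟨β, k⟩ hp ⟨β', k'⟩ hp' h
        simp only [Finset.coe_sigma, Set.mem_sigma_iff, Finset.mem_coe] at hp hp'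
        simp only [Prod.mk.injEq] at h
        obtain ⟨h1, rfl⟩ := h
        have : β = β' := by
          funext i
          have e1 := congrFun h1 i
          have e2 := hk2 β k hp.2 i
          have e3 := hk2 β' k hp'.2 i
          omega
        rw [this]
    _ ≤ E * (Q ^ n) ^ 2 * ∑ p ∈ parityIndices d n ×ˢ P, (∏ i, (σ i : ℝ) ^ p.2 i) * F p.1 ^ 2 := by
        gcongr
        intro p hp
        obtain ⟨⟨β, k⟩, hq, rfl⟩ := Finset.mem_image.1 hp
        obtain ⟨hβ, hk⟩ := Finset.mem_sigma.1 hq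
        refine Finset.mem_product.2 ⟨?_, hsub β hβ hk⟩
        have hs : ∑ i, (β i - 2 * k i) + 2 * ∑ i, k i = n := by
          rw [Finset.mul_sum, ← Finset.sum_add_distrib, ← hB β hβ]
          refine Finset.sum_congr rfl fun i _ => ?_
          have := hk2 β k hk i
          omega
        refine Finset.mem_filter.2 ⟨Fintype.mem_piFinset.2 fun i => Finset.mem_range.2 ?_, ?_, ?_⟩
        · have := hle β hβ i
          simp only
          omega
        · simp only
          omega
        · simp only [Nat.ModEq]
          omega
    _ = E * (Q ^ n) ^ 2 * ((∑ k ∈ P, ∏ i, (σ i : ℝ) ^ k i) *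
          ∑ α ∈ parityIndices d n, F α ^ 2) := by
        rw [Finset.sum_product, mul_comm (∑ k ∈ P, _), Finset.sum_mul_sum]
        congr 1
        refine Finset.sum_congr rfl fun α _ => Finset.sum_congr rfl fun k _ => mul_comm _ _
    _ ≤ _ := by
        rw [mul_assoc (E * (Q ^ n) ^ 2)]
        gcongr

/-! ### Upper bound for the form by a Schur test. -/

/-- The weight `κ ^ k` if `a = b + 2 * k`, and `0` if `a` is not of this form. -/
noncomputable def parityWeight (κ : ℝ) (a b : ℕ) : ℝ :=
  if b ≤ a ∧ Even (a - b) then κ ^ ((a - b) / 2) else 0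

theorem parityWeight_nonneg {κ : ℝ} (hκ : 0 ≤ κ) (a b : ℕ) : 0 ≤ parityWeight κ a b := by
  unfold parityWeight
  split_ifs <;> positivity

theorem parityWeight_add_two_mul (κ : ℝ) (b k : ℕ) : parityWeight κ (b + 2 * k) b = κ ^ k := by
  rw [parityWeight, if_pos ⟨by omega, by simp⟩]
  congr 1
  omega

/-- The condition `κ ≤ 4 / 5` is exactly what `(1 + 5 κ) * (1 - κ) ≥ 1` needs for positive `κ`. An
exponential bound equal to `1` at `κ = 0` multiplies well over coordinates. -/
theorem one_div_one_sub_le_exp {κ : ℝ} (hκ : 0 ≤ κ) (hκ' : κ ≤ 4 / 5) :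
    (1 - κ)⁻¹ ≤ Real.exp (5 * κ) := by
  refine le_trans ?_ (Real.add_one_le_exp _)
  rw [inv_le_iff_one_le_mul₀ (by linarith)]
  nlinarith

theorem sum_pow_le_exp {κ : ℝ} (hκ : 0 ≤ κ) (hκ' : κ ≤ 4 / 5) (A : Finset ℕ) :
    ∑ k ∈ A, κ ^ k ≤ Real.exp (5 * κ) := by
  have h1 : κ < 1 := by linarith
  have := Summable.sum_le_tsum A (fun _ _ => by positivity) (summable_geometric_of_lt_one hκ h1)
  rw [tsum_geometric_of_lt_one hκ h1] at this
  exact this.trans (one_div_one_sub_le_exp hκ hκ')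

theorem sum_parityWeight_right_le {κ : ℝ} (hκ : 0 ≤ κ) (hκ' : κ ≤ 4 / 5) (a : ℕ) (A : Finset ℕ) :
    ∑ b ∈ A, parityWeight κ a b ≤ Real.exp (5 * κ) := by
  classical
  unfold parityWeight
  rw [← Finset.sum_filter, ← Finset.sum_image (f := fun k : ℕ => κ ^ k)
    (g := fun b : ℕ => (a - b) / 2)]
  · exact sum_pow_le_exp hκ hκ' _
  · intro x hx y hy hxy
    simp only [Finset.coe_filter, Set.mem_ofPred_eq, Nat.even_iff] at hx hy hxy
    omega

/-- For `b ≥ 1`, `4 / 5 ≤ (9 / 10) ^ 2` reduces the sum to a negative binomial series with value `10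
^ (b + 1) ≤ 100 ^ b`. The case `b = 0` is separate because a constant factor there would be raised
to the power `d`. -/
theorem sum_parityWeight_mul_choose_le {κ : ℝ} (hκ : 0 ≤ κ) (hκ' : κ ≤ 4 / 5) (b : ℕ)
    (A : Finset ℕ) :
    ∑ a ∈ A, parityWeight κ a b * a.choose b ≤ 100 ^ b * Real.exp (5 * κ) := by
  classical
  rcases Nat.eq_zero_or_pos b with rfl | hb
  · simp only [Nat.choose_zero_right, Nat.cast_one, mul_one, pow_zero, one_mul]
    unfold parityWeight
    rw [← Finset.sum_filter, ← Finset.sum_image (f := fun k : ℕ => κ ^ k)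
      (g := fun a : ℕ => (a - 0) / 2)]
    · exact sum_pow_le_exp hκ hκ' _
    · intro x hx y hy hxy
      simp only [Finset.coe_filter, Set.mem_ofPred_eq, Nat.even_iff] at hx hy hxy
      omega
  · have h9 : ‖(9 / 10 : ℝ)‖ < 1 := by norm_num
    have hterm (a : ℕ) (ha : b ≤ a) : parityWeight κ a b * a.choose b
        ≤ ((a - b + b).choose b : ℝ) * (9 / 10 : ℝ) ^ (a - b) := by
      rw [Nat.sub_add_cancel ha, mul_comm]
      gcongr
      unfold parityWeight
      split_ifs with h
      · obtain ⟨k, hk⟩ := h.2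
        rw [hk, ← two_mul, Nat.mul_div_cancel_left _ (by norm_num), pow_mul]
        gcongr
        norm_num
        linarith
      · positivity
    have hA : ∑ a ∈ A, parityWeight κ a b * a.choose b
        = ∑ a ∈ A with b ≤ a, parityWeight κ a b * a.choose b := by
      rw [Finset.sum_filter_of_ne]
      intro a _ hne
      by_contra h
      apply hne
      rw [parityWeight, if_neg (fun h' => h h'.1), zero_mul]
    rw [hA]
    calc _ ≤ ∑ a ∈ A with b ≤ a, ((a - b + b).choose b : ℝ) * (9 / 10 : ℝ) ^ (a - b) :=
          Finset.sum_le_sum fun a ha => hterm a (Finset.mem_filter.1 ha).2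
      _ = ∑ j ∈ (A.filter fun a => b ≤ a).image fun a => a - b,
            ((j + b).choose b : ℝ) * (9 / 10 : ℝ) ^ j := by
          rw [Finset.sum_image]
          intro x hx y hy hxy
          simp only [Finset.coe_filter, Set.mem_ofPred_eq] at hx hy hxy
          omega
      _ ≤ 1 / (1 - 9 / 10) ^ (b + 1) := by
          rw [← tsum_choose_mul_geometric_of_norm_lt_one b h9]
          exact Summable.sum_le_tsum _ (fun _ _ => by positivity)
            (summable_choose_mul_geometric_of_norm_lt_one b h9)
      _ = 10 ^ (b + 1) := by
          rw [one_div, ← inv_pow]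
          norm_num
      _ ≤ 10 ^ (2 * b) := pow_le_pow_right₀ (by norm_num) (by omega)
      _ = 100 ^ b * 1 := by
          rw [pow_mul]
          norm_num
      _ ≤ _ := by
          gcongr
          exact Real.one_le_exp (by positivity)

/-- The closed formula for the mixed moment together with `(2 k)! ≤ (2 ^ k * k!) ^ 2`. The factor
`(r v) ^ (2 k)` is split evenly so that one half can be summed over `b` and the other, with the
binomial coefficient, over `a`. -/
theorem sq_integral_pow_mul_gaussHermite_le {v : ℝ≥0} (hv : 0 < v) {r : ℝ} (hr : 0 < r)
    (a b : ℕ) :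
    r ^ a / a.factorial * ((∫ x, x ^ a * gaussHermite v b x ∂gaussianReal 0 v) ^ 2
        / ((v : ℝ) ^ b * b.factorial))
      ≤ (r * v) ^ b * parityWeight (r * v) a b * (parityWeight (r * v) a b * a.choose b) := by
  have hv' : (0 : ℝ) < v := hv
  by_cases h : ∃ k, a = b + 2 * k
  · obtain ⟨k, rfl⟩ := h
    rw [integral_pow_mul_gaussHermite hv.ne', parityWeight_add_two_mul]
    have hch : ((b + 2 * k).factorial : ℝ)
        = (b + 2 * k).choose b * (b.factorial * (2 * k).factorial) := by
      have := Nat.add_choose_mul_factorial_mul_factorial b (2 * k)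
      rw [← Nat.choose_symm_add] at this
      rw [← mul_assoc]
      exact_mod_cast this.symm
    have h4 : ((2 * k).factorial : ℝ) ≤ (2 ^ k * k.factorial) ^ 2 := by
      have h1 : (2 * k).factorial = (2 * k).choose k * k.factorial * k.factorial := by
        have := Nat.add_choose_mul_factorial_mul_factorial k k
        rw [← two_mul] at this
        exact this.symm
      have h2 : (2 * k).choose k ≤ 4 ^ k := by
        have := Nat.choose_le_two_pow (2 * k) k
        rw [pow_mul] at this
        simpa using this
      have h3 : (2 * k).factorial ≤ (2 ^ k * k.factorial) ^ 2 := by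
        rw [h1]
        calc _ ≤ 4 ^ k * k.factorial * k.factorial := by gcongr
          _ = _ := by
            rw [mul_pow, ← pow_mul, mul_comm k 2, pow_mul]
            norm_num
            ring
      exact_mod_cast h3
    calc _ = (r * v) ^ b * ((r * v) ^ k * (r * v) ^ k) *
          (((b + 2 * k).factorial : ℝ) / (b.factorial * (2 ^ k * k.factorial) ^ 2)) := by
          have : ((b + 2 * k).factorial : ℝ) ≠ 0 := by positivity
          field_simp
          ring
      _ = (r * v) ^ b * ((r * v) ^ k * (r * v) ^ k) * ((b + 2 * k).choose b *
            (((2 * k).factorial : ℝ) / (2 ^ k * k.factorial) ^ 2)) := by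
          rw [hch]
          field_simp
      _ ≤ (r * v) ^ b * ((r * v) ^ k * (r * v) ^ k) * ((b + 2 * k).choose b * 1) := by
          gcongr
          exact div_le_one_of_le₀ h4 (by positivity)
      _ = _ := by ring
  · rw [integral_pow_mul_gaussHermite_eq_zero hv.ne' fun k hk => h ⟨k, hk⟩]
    have := parityWeight_nonneg (κ := r * v) (by positivity) a b
    simp only [ne_eq, OfNat.ofNat_ne_zero, not_false_eq_true, zero_pow, zero_div, mul_zero]
    positivity

/-- Upper bound for the form on the span of the Hermite functions of degree `n`. -/
theorem sum_mul_inner_monomialLp_sq_le {a : ℕ → ℝ} {M r τ : ℝ} (hM : 0 ≤ M) (hr : 0 < r)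
    (haM : ∀ m, a m * m.factorial ≤ M * r ^ m) {d : ℕ} {σ : Fin d → ℝ≥0} (hσ : ∀ i, 0 < σ i)
    (hrσ : ∀ i, r * σ i ≤ 4 / 5) (hτ : ∑ i, (σ i : ℝ) ≤ τ) {n : ℕ} (B : Finset (Fin d → ℕ))
    (hB : ∀ β ∈ B, ∑ i, β i = n) (b : (Fin d → ℕ) → ℝ) (I : Finset (Fin d → ℕ)) :
    ∑ α ∈ I, a (∑ i, α i) * Nat.multinomial Finset.univ α *
        (inner ℝ (monomialLp σ α) (∑ β ∈ B, b β • hermiteLp σ β)) ^ 2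
      ≤ M * r ^ n * 100 ^ n * Real.exp (10 * (r * τ)) *
        ∑ β ∈ B, (∏ i, (σ i : ℝ) ^ β i) * b β ^ 2 := by
  classical
  have hσ' (i : Fin d) : (0 : ℝ) < σ i := hσ i
  have hκ (i : Fin d) : 0 ≤ r * σ i := (mul_pos hr (hσ' i)).le
  set E := Real.exp (5 * (r * τ)) with hE
  have hEE : Real.exp (10 * (r * τ)) = E * E := by
    rw [hE, ← Real.exp_add]
    ring_nf
  have hexp : ∏ i, Real.exp (5 * (r * σ i)) ≤ E := by
    rw [← Real.exp_sum, ← Finset.mul_sum, ← Finset.mul_sum, hE]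
    gcongr
  set p : (Fin d → ℕ) → (Fin d → ℕ) → ℝ := fun α β => ∏ i, parityWeight (r * σ i) (α i) (β i)
  set q : (Fin d → ℕ) → (Fin d → ℕ) → ℝ := fun α β =>
    ∏ i, parityWeight (r * σ i) (α i) (β i) * (α i).choose (β i)
  have hp (α β) : 0 ≤ p α β := Finset.prod_nonneg fun i _ => parityWeight_nonneg (hκ i) _ _
  have hq (α β) : 0 ≤ q α β := Finset.prod_nonneg fun i _ =>
    mul_nonneg (parityWeight_nonneg (hκ i) _ _) (Nat.cast_nonneg _)
  set D : (Fin d → ℕ) → ℝ := fun α => ∏ i, r ^ α i / (α i).factorial with hD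
  have hD0 (α) : 0 < D α := Finset.prod_pos fun i _ => by positivity
  set y : (Fin d → ℕ) → (Fin d → ℕ) → ℝ := fun α β => inner ℝ (monomialLp σ α) (hermiteLp σ β)
  -- The input of the Schur test: `p` is summable over `β` and `q` over `α`, both with
  -- dimension-free bounds, while `D α` absorbs the growth of `a` and the multinomial coefficient.
  have hy (α β) : D α * y α β ^ 2 ≤ r ^ (∑ i, β i) * (∏ i, (σ i : ℝ) ^ β i) * p α β * q α β := by
    simp only [y, inner_monomialLp_hermiteLp, mul_pow, inv_pow,
      Real.sq_sqrt (hermiteNormSq_pos hσ β).le]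
    rw [← Finset.prod_pow_eq_pow_sum, ← Finset.prod_mul_distrib, ← Finset.prod_mul_distrib,
      ← Finset.prod_mul_distrib, hermiteNormSq, ← Finset.prod_inv_distrib, ← Finset.prod_pow,
      ← Finset.prod_mul_distrib, ← Finset.prod_mul_distrib]
    refine Finset.prod_le_prod (fun i _ => by positivity) fun i _ => ?_
    refine le_trans (le_of_eq ?_) ((sq_integral_pow_mul_gaussHermite_le (hσ i) hr
      (α i) (β i)).trans (le_of_eq ?_))
    · rw [div_eq_mul_inv (_ ^ 2)]
      ring
    · rw [mul_pow]
  have hpsum (α) : ∑ β ∈ B, p α β ≤ E := by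
    have hsub : B ⊆ Fintype.piFinset fun _ => Finset.range (n + 1) := by
      intro β hβ
      refine Fintype.mem_piFinset.2 fun i => Finset.mem_range.2 (Nat.lt_succ_of_le ?_)
      rw [← hB β hβ]
      exact Finset.single_le_sum (f := β) (fun _ _ => Nat.zero_le _) (Finset.mem_univ i)
    refine (Finset.sum_le_sum_of_subset_of_nonneg hsub fun β _ _ => hp α β).trans ?_
    rw [← Finset.prod_univ_sum (fun _ => Finset.range (n + 1))
      (fun i j => parityWeight (r * σ i) (α i) j)]
    refine le_trans (Finset.prod_le_prod (fun i _ => Finset.sum_nonneg fun j _ =>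
      parityWeight_nonneg (hκ i) _ _) fun i _ => ?_) hexp
    exact sum_parityWeight_right_le (hκ i) (hrσ i) _ _
  have hqsum (β) (hβ : β ∈ B) : ∑ α ∈ I, q α β ≤ 100 ^ n * E := by
    obtain ⟨N, hN⟩ : ∃ N, I ⊆ Fintype.piFinset fun _ => Finset.range N := by
      refine ⟨I.sup (fun α => ∑ i, α i) + 1, fun α hα => Fintype.mem_piFinset.2 fun i =>
        Finset.mem_range.2 (Nat.lt_succ_of_le ?_)⟩
      exact (Finset.single_le_sum (f := α) (fun _ _ => Nat.zero_le _) (Finset.mem_univ i)).trans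
        (Finset.le_sup (f := fun α : Fin d → ℕ => ∑ i, α i) hα)
    refine (Finset.sum_le_sum_of_subset_of_nonneg hN fun α _ _ => hq α β).trans ?_
    rw [← Finset.prod_univ_sum (fun _ => Finset.range N)
      (fun i j => parityWeight (r * σ i) j (β i) * j.choose (β i))]
    calc _ ≤ ∏ i, 100 ^ β i * Real.exp (5 * (r * σ i)) :=
          Finset.prod_le_prod (fun i _ => Finset.sum_nonneg fun j _ =>
            mul_nonneg (parityWeight_nonneg (hκ i) _ _) (Nat.cast_nonneg _)) fun i _ =>
            sum_parityWeight_mul_choose_le (hκ i) (hrσ i) _ _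
      _ ≤ _ := by
          rw [Finset.prod_mul_distrib, Finset.prod_pow_eq_pow_sum, hB β hβ]
          gcongr
  have hone (α) (_ : α ∈ I) : a (∑ i, α i) * Nat.multinomial Finset.univ α *
      (inner ℝ (monomialLp σ α) (∑ β ∈ B, b β • hermiteLp σ β)) ^ 2 ≤
      M * (E * ∑ β ∈ B, r ^ n * (∏ i, (σ i : ℝ) ^ β i) * b β ^ 2 * q α β) := by
    have h1 : a (∑ i, α i) * Nat.multinomial Finset.univ α ≤ M * D α := by
      have hm : (Nat.multinomial Finset.univ α : ℝ) * ∏ i, ((α i).factorial : ℝ)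
          = (∑ i, α i).factorial := by
        rw [mul_comm]
        exact_mod_cast Nat.multinomial_spec Finset.univ α
      have hf : (0 : ℝ) < ∏ i, ((α i).factorial : ℝ) := Finset.prod_pos fun i _ => by positivity
      rw [hD]
      simp only [Finset.prod_div_distrib, Finset.prod_pow_eq_pow_sum]
      rw [mul_div_assoc', le_div_iff₀ hf, mul_assoc, hm]
      exact haM _
    have hin : inner ℝ (monomialLp σ α) (∑ β ∈ B, b β • hermiteLp σ β) = ∑ β ∈ B, b β * y α β := by
      rw [inner_sum]
      exact Finset.sum_congr rfl fun β _ => inner_smul_right _ _ _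
    have hcs : D α * (∑ β ∈ B, b β * y α β) ^ 2 ≤ (∑ β ∈ B, p α β) *
        ∑ β ∈ B, r ^ n * (∏ i, (σ i : ℝ) ^ β i) * b β ^ 2 * q α β := by
      have : (∑ β ∈ B, b β * y α β) ^ 2 ≤ (∑ β ∈ B, p α β) *
          ∑ β ∈ B, (r ^ n * (∏ i, (σ i : ℝ) ^ β i) * b β ^ 2 * q α β) / D α := by
        refine Finset.sum_sq_le_sum_mul_sum_of_sq_le_mul _ (fun β _ => hp α β)
          (fun β _ => ?_) fun β hβ => ?_
        · have := hq α β
          have := hD0 α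
          positivity
        · rw [mul_div_assoc', le_div_iff₀ (hD0 α)]
          have h2 := mul_le_mul_of_nonneg_left (hy α β) (sq_nonneg (b β))
          rw [hB β hβ] at h2
          refine le_trans (le_of_eq ?_) (h2.trans (le_of_eq ?_)) <;> ring
      rw [← Finset.sum_div, mul_div_assoc', le_div_iff₀ (hD0 α)] at this
      rwa [mul_comm]
    rw [hin]
    calc _ ≤ M * D α * (∑ β ∈ B, b β * y α β) ^ 2 := by gcongr
      _ = M * (D α * (∑ β ∈ B, b β * y α β) ^ 2) := by ring
      _ ≤ M * ((∑ β ∈ B, p α β) * ∑ β ∈ B, r ^ n * (∏ i, (σ i : ℝ) ^ β i) * b β ^ 2 * q α β) := by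
          gcongr
      _ ≤ _ := by
          gcongr
          · exact Finset.sum_nonneg fun β _ => by
              have := hq α β
              positivity
          · exact hpsum α
  calc _ ≤ ∑ α ∈ I, M * (E * ∑ β ∈ B, r ^ n * (∏ i, (σ i : ℝ) ^ β i) * b β ^ 2 * q α β) :=
        Finset.sum_le_sum hone
    _ = M * (E * ∑ β ∈ B, r ^ n * (∏ i, (σ i : ℝ) ^ β i) * b β ^ 2 * ∑ α ∈ I, q α β) := by
        rw [← Finset.mul_sum, ← Finset.mul_sum, Finset.sum_comm]
        simp_rw [Finset.mul_sum]
    _ ≤ M * (E * ∑ β ∈ B, r ^ n * (∏ i, (σ i : ℝ) ^ β i) * b β ^ 2 * (100 ^ n * E)) := by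
        gcongr with β hβ
        exact hqsum β hβ
    _ = _ := by
        rw [hEE]
        simp_rw [Finset.mul_sum]
        exact Finset.sum_congr rfl fun β _ => by ring

/-! ### Expansion of the inner-product kernel into monomials. -/

theorem measurePreserving_neg_diagGaussian {d : ℕ} (σ : Fin d → ℝ≥0) :
    MeasurePreserving (fun x : Fin d → ℝ => -x) (diagGaussian σ) (diagGaussian σ) := by
  unfold diagGaussian
  refine measurePreserving_pi (f := fun _ (x : ℝ) => -x) _ _ fun i => ⟨measurable_neg, ?_⟩
  rw [gaussianReal_map_neg, neg_zero]

/-- Nonnegative coefficients bound every tail by `h |t|`, and `|t|` is `t` or `-t`. The two-term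
majorant is used because the reflected kernel is also square integrable, by symmetry of the
Gaussian. -/
theorem IsNonnegSeries.abs_sub_sum_le {h : ℝ → ℝ} {a : ℕ → ℝ} (hh : IsNonnegSeries h a) (N : ℕ)
    (t : ℝ) : |h t - ∑ m ∈ Finset.range N, a m * t ^ m| ≤ |h t| + |h (-t)| := by
  have h1 : |h t - ∑ m ∈ Finset.range N, a m * t ^ m| ≤ h |t| := by
    have hs := (hasSum_nat_add_iff' N).2 (hh.hasSum t)
    have hs' := (hasSum_nat_add_iff' N).2 (hh.hasSum |t|)
    have h2 : |h t - ∑ m ∈ Finset.range N, a m * t ^ m|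
        ≤ h |t| - ∑ m ∈ Finset.range N, a m * |t| ^ m := by
      rw [← Real.norm_eq_abs]
      refine hs.norm_le_of_bounded hs' fun m => ?_
      rw [norm_mul, norm_pow, Real.norm_of_nonneg (hh.nonneg _), Real.norm_eq_abs]
    have h3 : 0 ≤ ∑ m ∈ Finset.range N, a m * |t| ^ m :=
      Finset.sum_nonneg fun m _ => mul_nonneg (hh.nonneg m) (by positivity)
    linarith
  refine h1.trans ((le_abs_self _).trans ?_)
  rcases abs_choice t with ht | ht <;> rw [ht]
  · exact le_add_of_nonneg_right (abs_nonneg _)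
  · exact le_add_of_nonneg_left (abs_nonneg _)

/-- The multi-indices of degree less than `N`. -/
def multiIndicesBelow (d N : ℕ) : Finset (Fin d → ℕ) :=
  (Finset.range N).biUnion fun m => Finset.piAntidiag Finset.univ m

theorem mem_multiIndicesBelow {d N : ℕ} {α : Fin d → ℕ} :
    α ∈ multiIndicesBelow d N ↔ ∑ i, α i < N := by
  simp [multiIndicesBelow]

theorem sum_multiIndicesBelow {d : ℕ} (a : ℕ → ℝ) (N : ℕ) (x y : Fin d → ℝ) :
    ∑ α ∈ multiIndicesBelow d N, a (∑ i, α i) * Nat.multinomial Finset.univ α *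
      (multiMonomial α x * multiMonomial α y)
      = ∑ m ∈ Finset.range N, a m * (∑ i, x i * y i) ^ m := by
  rw [multiIndicesBelow, Finset.sum_biUnion]
  · refine Finset.sum_congr rfl fun m _ => ?_
    rw [Finset.sum_pow_eq_sum_piAntidiag, Finset.mul_sum]
    refine Finset.sum_congr rfl fun α hα => ?_
    rw [(Finset.mem_piAntidiag.1 hα).1]
    simp only [multiMonomial, ← Finset.prod_mul_distrib, mul_pow]
    ring
  · intro m _ m' _ hne
    refine Finset.disjoint_left.2 fun α hα hα' => hne ?_
    rw [← (Finset.mem_piAntidiag.1 hα).1, ← (Finset.mem_piAntidiag.1 hα').1]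

theorem tendsto_eLpNorm_innerProductKernel_sub {h : ℝ → ℝ} {a : ℕ → ℝ} (hh : IsNonnegSeries h a)
    {d : ℕ} {σ : Fin d → ℝ≥0}
    (hk : IsHilbertSchmidtKernel (innerProductKernel h d) (diagGaussian σ)) :
    Filter.Tendsto (fun N => eLpNorm (fun p : (Fin d → ℝ) × (Fin d → ℝ) =>
      innerProductKernel h d p.1 p.2 - ∑ α ∈ multiIndicesBelow d N,
        a (∑ i, α i) * Nat.multinomial Finset.univ α * (multiMonomial α p.1 * multiMonomial α p.2))
      2 ((diagGaussian σ).prod (diagGaussian σ))) Filter.atTop (nhds 0) := by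
  set ν := (diagGaussian σ).prod (diagGaussian σ)
  set k : (Fin d → ℝ) × (Fin d → ℝ) → ℝ := fun p => innerProductKernel h d p.1 p.2 with hkdef
  have hmp : MeasurePreserving (fun p : (Fin d → ℝ) × (Fin d → ℝ) => (p.1, -p.2)) ν ν :=
    (MeasurePreserving.id _).prod (measurePreserving_neg_diagGaussian σ)
  have hk1 : MemLp k 2 ν := hk
  have hk2 : MemLp (fun p => k (p.1, -p.2)) 2 ν := hk1.comp_measurePreserving hmp
  have hG : MemLp (fun p => |k p| + |k (p.1, -p.2)|) 2 ν := hk1.abs.add hk2.abs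
  have hcont : Continuous h := hh.contDiff.continuous
  have hmeas (N : ℕ) : Measurable fun p : (Fin d → ℝ) × (Fin d → ℝ) => k p -
      ∑ m ∈ Finset.range N, a m * (∑ i, p.1 i * p.2 i) ^ m := by
    simp only [hkdef, innerProductKernel]
    refine Continuous.measurable ?_
    fun_prop
  have hsq : Filter.Tendsto (fun N => ∫⁻ p, ‖k p -
      ∑ m ∈ Finset.range N, a m * (∑ i, p.1 i * p.2 i) ^ m‖ₑ ^ 2 ∂ν) Filter.atTop (nhds 0) := by
    have := tendsto_lintegral_of_dominated_convergence (μ := ν)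
      (F := fun N p => ‖k p - ∑ m ∈ Finset.range N, a m * (∑ i, p.1 i * p.2 i) ^ m‖ₑ ^ 2)
      (f := fun _ => 0) (fun p => ‖|k p| + |k (p.1, -p.2)|‖ₑ ^ 2)
      (fun N => (hmeas N).enorm.pow_const 2) ?_ ?_ ?_
    · simpa using this
    · intro N
      refine .of_forall fun p => ?_
      simp only
      gcongr
      rw [enorm_le_iff_norm_le, Real.norm_eq_abs, Real.norm_of_nonneg (by positivity)]
      have h2 := hh.abs_sub_sum_le N (∑ i, p.1 i * p.2 i)
      simpa [hkdef, innerProductKernel] using h2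
    · rw [← eLpNorm_two_sq_eq_lintegral]
      exact (ENNReal.pow_lt_top hG.2).ne
    · refine .of_forall fun p => ?_
      have h1 := (hh.hasSum (∑ i, p.1 i * p.2 i)).tendsto_sum_nat
      have h2 := (tendsto_const_nhds (x := h (∑ i, p.1 i * p.2 i))).sub h1
      rw [sub_self] at h2
      have h3 := h2.enorm
      have h4 := ((ENNReal.continuous_pow 2).tendsto _).comp h3
      simpa [hkdef, innerProductKernel, Function.comp_def] using h4
  simp only [sum_multiIndicesBelow]
  have h5 := (ENNReal.continuous_rpow_const (y := 2⁻¹)).tendsto 0 |>.comp hsq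
  rw [ENNReal.zero_rpow_of_pos (by norm_num)] at h5
  refine h5.congr fun N => ?_
  rw [Function.comp, ← eLpNorm_two_sq_eq_lintegral, ← ENNReal.rpow_two, ← ENNReal.rpow_mul]
  norm_num
  rfl

/-- The integral operator of an inner-product kernel, as a compact symmetric operator, together with
lower bounds for its quadratic form. -/
theorem exists_innerProductKernel_operator {h : ℝ → ℝ} {a : ℕ → ℝ} (hh : IsNonnegSeries h a)
    {d : ℕ} {σ : Fin d → ℝ≥0}
    (hk : IsHilbertSchmidtKernel (innerProductKernel h d) (diagGaussian σ)) :
    ∃ T : Lp ℝ 2 (diagGaussian σ) →L[ℝ] Lp ℝ 2 (diagGaussian σ),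
      (∀ f : Lp ℝ 2 (diagGaussian σ), T f =ᵐ[diagGaussian σ]
        integralOperator (innerProductKernel h d) (diagGaussian σ) f) ∧
      IsCompactOperator T ∧
      (T : Lp ℝ 2 (diagGaussian σ) →ₗ[ℝ] Lp ℝ 2 (diagGaussian σ)).IsSymmetric ∧
      (∀ (f : Lp ℝ 2 (diagGaussian σ)) (A : Finset (Fin d → ℕ)),
        ∑ α ∈ A, a (∑ i, α i) * Nat.multinomial Finset.univ α * (inner ℝ (monomialLp σ α) f) ^ 2
          ≤ inner ℝ (T f) f) ∧
      ∀ (f : Lp ℝ 2 (diagGaussian σ)) (C : ℝ), (∀ A : Finset (Fin d → ℕ),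
        ∑ α ∈ A, a (∑ i, α i) * Nat.multinomial Finset.univ α * (inner ℝ (monomialLp σ α) f) ^ 2
          ≤ C) → inner ℝ (T f) f ≤ C := by
  obtain ⟨T, hT, hc, hs, hform⟩ := exists_isCompactOperator_integralOperator hk
    (φ := multiMonomial) (memLp_multiMonomial σ)
    (fun α => a (∑ i, α i) * Nat.multinomial Finset.univ α) (multiIndicesBelow d)
    (tendsto_eLpNorm_innerProductKernel_sub hh hk)
  refine ⟨T, hT, hc, hs, fun f A => ?_, fun f C hC => ?_⟩
  · refine ge_of_tendsto (hform f) ?_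
    filter_upwards [Filter.eventually_ge_atTop (A.sup (fun α => ∑ i, α i) + 1)] with N hN
    refine Finset.sum_le_sum_of_subset_of_nonneg (fun α hα => ?_) fun α _ _ =>
      mul_nonneg (mul_nonneg (hh.nonneg _) (Nat.cast_nonneg _)) (sq_nonneg _)
    rw [mem_multiIndicesBelow]
    have := Finset.le_sup (f := fun α : Fin d → ℕ => ∑ i, α i) hα
    omega
  · exact le_of_tendsto (hform f) (.of_forall fun N => hC _)

/-! ### Growth of the coefficients forced by the Hilbert–Schmidt condition. -/

/-- Values `s` of the variance that are compatible with the growth of the coefficients. -/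
def admissibleVariances (a : ℕ → ℝ) (τ : ℝ) : Set ℝ :=
  {s | 0 < s ∧ s ≤ τ ∧ ∃ C, ∀ m : ℕ, a m * m.factorial * (2 * s) ^ m ≤ C * (2 * m + 1)}

/-- Testing the form on `f = x i ^ m` gives `a m * ‖f‖ ^ 2 ≤ ‖T‖`, and `‖f‖ ^ 2` is at least `m! *
(2 * σ i) ^ m / (2 * m + 1)` by the central binomial bound. The constant depends on `‖T‖`, but
membership in the set does not record it. -/
theorem mem_admissibleVariances {h : ℝ → ℝ} {a : ℕ → ℝ} (hh : IsNonnegSeries h a) {τ : ℝ}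
    {d : ℕ} {σ : Fin d → ℝ≥0} (hσ : ∀ i, 0 < σ i) (hτ : ∑ i, (σ i : ℝ) ≤ τ)
    (hk : IsHilbertSchmidtKernel (innerProductKernel h d) (diagGaussian σ)) (i : Fin d) :
    (σ i : ℝ) ∈ admissibleVariances a τ := by
  classical
  have hσ' : (0 : ℝ) < σ i := hσ i
  refine ⟨hσ', (Finset.single_le_sum (f := fun i => (σ i : ℝ)) (fun _ _ => NNReal.coe_nonneg _)
    (Finset.mem_univ i)).trans hτ, ?_⟩
  obtain ⟨T, -, -, -, hlow, -⟩ := exists_innerProductKernel_operator hh hk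
  refine ⟨‖T‖, fun m => ?_⟩
  set α : Fin d → ℕ := Pi.single i m with hα
  have hdeg : ∑ j, α j = m := by simp [hα]
  have hmul : Nat.multinomial Finset.univ α = 1 := by
    have := Nat.multinomial_spec Finset.univ α
    rw [hdeg] at this
    have hp : ∏ j, (α j).factorial = m.factorial := by
      rw [Finset.prod_eq_single i]
      · simp [hα]
      · intro j _ hj
        simp [hα, hj]
      · simp
    rw [hp] at this
    exact Nat.eq_of_mul_eq_mul_left m.factorial_pos (by rw [this, mul_one])
  set f := monomialLp σ α
  set V : ℝ := (σ i : ℝ) ^ m * (2 * m).factorial / (2 ^ m * m.factorial) with hV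
  have hV0 : 0 < V := by positivity
  have hf : inner ℝ f f = V := by
    rw [inner_monomialLp_monomialLp, Finset.prod_eq_single i]
    · rw [← two_mul]
      simp only [hα, Pi.single_eq_same]
      rw [integral_pow_gaussianReal_even (hσ i).ne']
    · intro j _ hj
      simp [hα, hj]
    · simp
  have h1 := hlow f {α}
  rw [Finset.sum_singleton, hdeg, hmul, Nat.cast_one, mul_one, hf] at h1
  have h2 : inner ℝ (T f) f ≤ ‖T‖ * V := by
    rw [← hf, real_inner_self_eq_norm_sq]
    refine (real_inner_le_norm _ _).trans ?_
    rw [sq, ← mul_assoc]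
    gcongr
    exact T.le_opNorm f
  have h3 : a m * V ≤ ‖T‖ := by
    refine le_of_mul_le_mul_right ?_ hV0
    refine le_trans (le_of_eq ?_) (h1.trans h2)
    ring
  have h4 : m.factorial * (2 * (σ i : ℝ)) ^ m ≤ (2 * m + 1) * V := by
    have hcb : 4 ^ m ≤ (2 * m + 1) * m.centralBinom := by
      rcases Nat.eq_zero_or_pos m with rfl | hm
      · simp
      · refine (Nat.four_pow_le_two_mul_self_mul_centralBinom m hm).trans ?_
        gcongr
        omega
    have hcb' : (2 * m).factorial = m.centralBinom * m.factorial * m.factorial := by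
      have := Nat.add_choose_mul_factorial_mul_factorial m m
      rw [← two_mul] at this
      exact this.symm
    have hcb'' : (4 : ℝ) ^ m ≤ (2 * m + 1) * m.centralBinom := by exact_mod_cast hcb
    rw [hV, hcb', mul_pow]
    push_cast
    calc _ = (4 : ℝ) ^ m * ((σ i : ℝ) ^ m * m.factorial / 2 ^ m) := by
          rw [show (4 : ℝ) = 2 * 2 by norm_num, mul_pow]
          field_simp
      _ ≤ ((2 * m + 1) * m.centralBinom) * ((σ i : ℝ) ^ m * m.factorial / 2 ^ m) := by gcongr
      _ = _ := by
          field_simp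
  calc _ = a m * (m.factorial * (2 * (σ i : ℝ)) ^ m) := by ring
    _ ≤ a m * ((2 * m + 1) * V) := mul_le_mul_of_nonneg_left h4 (hh.nonneg m)
    _ = (a m * V) * (2 * m + 1) := by ring
    _ ≤ _ := by gcongr

/-- Uniformity in `σ` and `d`: a single admissible `s₀` above `3 / 4` of the supremum fixes `M` and
`r`. With `r = 3 / (5 * s₀)`, `r * 2 * s₀ = 6 / 5 > 1` absorbs the linear factor, while `r * s ≤ (3
/ 5) * (4 / 3) = 4 / 5` for all admissible `s`. -/
theorem exists_growth_bound {a : ℕ → ℝ} (ha : ∀ m, 0 ≤ a m) {τ : ℝ}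
    (hne : (admissibleVariances a τ).Nonempty) :
    ∃ M r : ℝ, 0 ≤ M ∧ 0 < r ∧ (∀ m, a m * m.factorial ≤ M * r ^ m) ∧
      ∀ s ∈ admissibleVariances a τ, r * s ≤ 4 / 5 := by
  have hbdd : BddAbove (admissibleVariances a τ) := ⟨τ, fun s hs => hs.2.1⟩
  obtain ⟨s₁, hs₁⟩ := hne
  have hS : 0 < sSup (admissibleVariances a τ) := hs₁.1.trans_le (le_csSup hbdd hs₁)
  obtain ⟨s₀, hs₀, hlt⟩ := exists_lt_of_lt_csSup (b := 3 / 4 * sSup (admissibleVariances a τ))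
    ⟨s₁, hs₁⟩ (by linarith)
  obtain ⟨h0, -, C, hC⟩ := hs₀
  have hC0 : 0 ≤ C := by
    have := hC 0
    simp only [Nat.factorial_zero, Nat.cast_one, pow_zero, mul_one, Nat.cast_zero, mul_zero,
      zero_add] at this
    exact (ha 0).trans this
  refine ⟨10 * C, 3 / (5 * s₀), by positivity, by positivity, fun m => ?_, fun s hs => ?_⟩
  · have h1 : a m * m.factorial ≤ C * (2 * m + 1) / (2 * s₀) ^ m := by
      rw [le_div_iff₀ (by positivity)]
      exact hC m
    refine h1.trans ?_
    rw [div_le_iff₀ (by positivity), mul_assoc, ← mul_pow]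
    have h2 : 3 / (5 * s₀) * (2 * s₀) = 1 + 1 / 5 := by
      field_simp
      norm_num
    rw [h2]
    have h3 := one_add_mul_le_pow (a := (1 / 5 : ℝ)) (by norm_num) m
    calc C * (2 * m + 1) ≤ C * (10 * (1 + m * (1 / 5))) := by
          gcongr
          have : (0 : ℝ) ≤ m := Nat.cast_nonneg m
          linarith
      _ ≤ C * (10 * (1 + 1 / 5) ^ m) := by gcongr
      _ = _ := by ring
  · have := le_csSup hbdd hs
    rw [div_mul_eq_mul_div, div_le_iff₀ (by positivity)]
    linarith

/-! ### Completeness of polynomials and the size of the index set. -/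

section Density

variable {d : ℕ}

theorem memLp_exp_abs_linear (σ : Fin d → ℝ≥0) (c : Fin d → ℝ) :
    MemLp (fun x : Fin d → ℝ => Real.exp |∑ i, c i * x i|) 2 (diagGaussian σ) := by
  have hmeas : Measurable fun x : Fin d → ℝ => Real.exp |∑ i, c i * x i| :=
    Continuous.measurable (by fun_prop)
  rw [memLp_two_iff_integrable_sq hmeas.aestronglyMeasurable]
  have h1 (i : Fin d) : Integrable (fun x : ℝ => Real.exp (2 * |c i| * |x|))
      (gaussianReal 0 (σ i)) :=
    integrable_exp_mul_abs (X := fun x => x) (integrable_exp_mul_gaussianReal _)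
      (integrable_exp_mul_gaussianReal _)
  have h2 := Integrable.fintype_prod (f := fun i x => Real.exp (2 * |c i| * |x|)) h1
  refine Integrable.mono' h2 (hmeas.pow_const 2).aestronglyMeasurable (.of_forall fun x => ?_)
  rw [Real.norm_of_nonneg (by positivity), ← Real.exp_sum, ← Real.exp_nat_mul]
  gcongr
  push_cast
  calc 2 * |∑ i, c i * x i| ≤ 2 * ∑ i, |c i * x i| := by
        gcongr
        exact Finset.abs_sum_le_sum_abs _ _
    _ = _ := by
        rw [Finset.mul_sum]
        refine Finset.sum_congr rfl fun i _ => ?_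
        rw [abs_mul]
        ring

/-- The exponential series may be integrated term by term since `exp |∑ c i * x i|` is in `L²`, and
each term is a combination of vanishing moments. -/
theorem integral_cexp_mul_eq_zero_of_moments {σ : Fin d → ℝ≥0} {f : (Fin d → ℝ) → ℝ}
    (hf : MemLp f 2 (diagGaussian σ))
    (h0 : ∀ α, ∫ x, multiMonomial α x * f x ∂diagGaussian σ = 0) (c : Fin d → ℝ) :
    ∫ x, Complex.exp ((∑ i, c i * x i : ℝ) * Complex.I) * (f x : ℂ) ∂diagGaussian σ = 0 := by
  set y : (Fin d → ℝ) → ℝ := fun x => ∑ i, c i * x i with hy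
  have hyc : Continuous y := by fun_prop
  have hpow (n : ℕ) : ∫ x, (y x) ^ n * f x ∂diagGaussian σ = 0 := by
    have hexp (x : Fin d → ℝ) : (y x) ^ n * f x = ∑ α ∈ Finset.piAntidiag Finset.univ n,
        ((Nat.multinomial Finset.univ α : ℝ) * ∏ i, c i ^ α i) * (multiMonomial α x * f x) := by
      rw [hy, Finset.sum_pow_eq_sum_piAntidiag, Finset.sum_mul]
      refine Finset.sum_congr rfl fun α _ => ?_
      simp only [mul_pow, Finset.prod_mul_distrib, multiMonomial]
      ring
    simp only [hexp]
    rw [integral_finsetSum]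
    · refine Finset.sum_eq_zero fun α _ => ?_
      rw [integral_const_mul, h0, mul_zero]
    · intro α _
      exact ((memLp_multiMonomial σ α).integrable_mul hf).const_mul _
  have hexpR (t : ℝ) : HasSum (fun n : ℕ => t ^ n / n.factorial) (Real.exp t) := by
    rw [Real.exp_eq_exp_ℝ]
    exact NormedSpace.expSeries_div_hasSum_exp t
  have hexpC (z : ℂ) : HasSum (fun n : ℕ => z ^ n / n.factorial) (Complex.exp z) := by
    rw [Complex.exp_eq_exp_ℂ]
    exact NormedSpace.expSeries_div_hasSum_exp z
  have hbs (x : Fin d → ℝ) : HasSum (fun n : ℕ => |y x| ^ n / n.factorial * |f x|)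
      (Real.exp |y x| * |f x|) := (hexpR |y x|).mul_right _
  have key := hasSum_integral_of_dominated_convergence (μ := diagGaussian σ)
    (F := fun (n : ℕ) x => ((y x : ℂ) * Complex.I) ^ n / n.factorial * (f x : ℂ))
    (f := fun x => Complex.exp ((y x : ℂ) * Complex.I) * (f x : ℂ))
    (fun n x => |y x| ^ n / n.factorial * |f x|)
    (fun n => by
      have h1 : Continuous fun x => ((y x : ℂ) * Complex.I) ^ n / (n.factorial : ℂ) := by fun_prop
      exact h1.aestronglyMeasurable.mul (Complex.continuous_ofReal.comp_aestronglyMeasurable hf.1))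
    (fun n => .of_forall fun x => le_of_eq (by simp))
    (.of_forall fun x => (hbs x).summable)
    (by
      simp only [(hbs _).tsum_eq]
      exact (memLp_exp_abs_linear σ c).integrable_mul hf.abs)
    (.of_forall fun x => (hexpC _).mul_right _)
  refine key.unique ?_
  convert hasSum_zero with n
  have h2 (x : Fin d → ℝ) : ((y x : ℂ) * Complex.I) ^ n / n.factorial * (f x : ℂ)
      = (Complex.I ^ n / n.factorial) * (((y x) ^ n * f x : ℝ) : ℂ) := by
    push_cast
    ring
  simp only [h2]
  rw [integral_const_mul, integral_complex_ofReal, hpow]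
  simp

/-- Polynomials are dense in `L²` of a Gaussian measure. -/
theorem eq_zero_of_inner_monomialLp_eq_zero {σ : Fin d → ℝ≥0} {f : Lp ℝ 2 (diagGaussian σ)}
    (h0 : ∀ α, inner ℝ (monomialLp σ α) f = 0) : f = 0 := by
  have hf := Lp.memLp f
  have hint : Integrable f (diagGaussian σ) := hf.integrable (by norm_num)
  have hmom (α) : ∫ x, multiMonomial α x * f x ∂diagGaussian σ = 0 := by
    rw [← h0 α, L2.inner_def]
    refine integral_congr_ae ?_
    filter_upwards [(memLp_multiMonomial σ α).coeFn_toLp] with x hx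
    rw [monomialLp, hx, RCLike.inner_apply, conj_trivial, mul_comm]
  have hfin1 := isFiniteMeasure_withDensity_ofReal hint.2
  have hfin2 := isFiniteMeasure_withDensity_ofReal hint.neg.2
  have hm1 : AEMeasurable (fun x => ENNReal.ofReal (f x)) (diagGaussian σ) :=
    hint.1.aemeasurable.ennreal_ofReal
  have hm2 : AEMeasurable (fun x => ENNReal.ofReal ((-⇑f) x)) (diagGaussian σ) :=
    hint.neg.1.aemeasurable.ennreal_ofReal
  -- The positive and negative parts of `f` are densities of finite measures, and the vanishing
  -- Fourier transform of `f` says that their characteristic functions agree.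
  have heq : (diagGaussian σ).withDensity (fun x => ENNReal.ofReal (f x))
      = (diagGaussian σ).withDensity (fun x => ENNReal.ofReal ((-⇑f) x)) := by
    refine Measure.ext_of_charFunDual ?_
    ext L
    have hL (x : Fin d → ℝ) : L x = ∑ i, L (Pi.single i 1) * x i := by
      conv_lhs => rw [pi_eq_sum_univ' x]
      rw [map_sum]
      refine Finset.sum_congr rfl fun i _ => ?_
      rw [map_smul, smul_eq_mul, mul_comm]
    have h1 := integral_cexp_mul_eq_zero_of_moments hf hmom fun i => L (Pi.single i 1)
    simp only [← hL] at h1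
    have hbd (g : (Fin d → ℝ) → ℝ) (hg : Integrable g (diagGaussian σ)) :
        Integrable (fun x => g x • Complex.exp ((L x : ℂ) * Complex.I)) (diagGaussian σ) := by
      refine hg.smul_bdd 1 ?_ (.of_forall fun x => ?_)
      · exact Continuous.aestronglyMeasurable (by fun_prop)
      · rw [Complex.norm_exp_ofReal_mul_I]
    rw [charFunDual_apply, charFunDual_apply, integral_withDensity_eq_integral_toReal_smul₀ hm1
      (.of_forall fun x => ENNReal.ofReal_lt_top), integral_withDensity_eq_integral_toReal_smul₀ hm2
      (.of_forall fun x => ENNReal.ofReal_lt_top), ← sub_eq_zero, ← integral_sub]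
    · rw [← h1]
      refine integral_congr_ae (.of_forall fun x => ?_)
      simp only [← sub_smul, ENNReal.toReal_ofReal', Pi.neg_apply]
      have : max (f x) 0 - max (-f x) 0 = f x := by
        rcases le_total (f x) 0 with h | h
        · rw [max_eq_right h, max_eq_left (by linarith)]
          ring
        · rw [max_eq_left h, max_eq_right (by linarith)]
          ring
      rw [this, Complex.real_smul, mul_comm]
    · simp only [ENNReal.toReal_ofReal']
      exact hbd _ hint.pos_part
    · simp only [ENNReal.toReal_ofReal']
      exact hbd _ hint.neg.pos_part
  rw [withDensity_eq_iff hm1 hm2 hint.lintegral_lt_top.ne] at heq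
  rw [Lp.eq_zero_iff_ae_eq_zero]
  filter_upwards [heq] with x hx
  have h2 := congrArg ENNReal.toReal hx
  simp only [ENNReal.toReal_ofReal', Pi.neg_apply] at h2
  rcases le_total (f x) 0 with h | h
  · rw [max_eq_right h, max_eq_left (by linarith)] at h2
    simpa using h2.symm
  · rw [max_eq_left h, max_eq_right (by linarith)] at h2
    exact h2

/-- Each of the countably many monomials has only countably many nonzero coefficients, and by
density no basis vector is orthogonal to all monomials. -/
theorem countable_index_of_hilbertBasis {σ : Fin d → ℝ≥0} {J : Type*}
    (e : HilbertBasis J ℝ (Lp ℝ 2 (diagGaussian σ))) : Countable J := by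
  have h1 (α : Fin d → ℕ) : {j | inner ℝ (monomialLp σ α) (e j) ≠ 0}.Countable := by
    refine (e.summable_inner_mul_inner (monomialLp σ α) (monomialLp σ α)).countable_support.mono ?_
    intro j hj
    rw [Function.mem_support, real_inner_comm (e j)]
    exact mul_ne_zero (by rwa [real_inner_comm]) (by rwa [real_inner_comm])
  rw [← Set.countable_univ_iff]
  refine (Set.countable_iUnion h1).mono fun j _ => ?_
  rw [Set.mem_iUnion]
  by_contra h
  push Not at h
  have := eq_zero_of_inner_monomialLp_eq_zero (f := e j) fun α => by simpa using h α
  have h2 := e.orthonormal.1 j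
  rw [this, norm_zero] at h2
  exact zero_ne_one h2

/-- In dimension zero `L²` consists of the constants. This case is separate because there is no
coordinate whose powers could supply indices of large degree. -/
theorem subsingleton_index_of_hilbertBasis {σ : Fin 0 → ℝ≥0} {J : Type*}
    (e : HilbertBasis J ℝ (Lp ℝ 2 (diagGaussian σ))) : Subsingleton J := by
  refine ⟨fun i j => ?_⟩
  by_contra hij
  set g := monomialLp σ 0
  have hg : inner ℝ g g = (1 : ℝ) := by
    rw [inner_monomialLp_monomialLp]
    simp
  have hpar (v : Lp ℝ 2 (diagGaussian σ)) : v = inner ℝ g v • g := by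
    rw [← sub_eq_zero]
    refine eq_zero_of_inner_monomialLp_eq_zero fun α => ?_
    rw [Subsingleton.elim α 0, inner_sub_right, inner_smul_right]
    change inner ℝ g v - _ * inner ℝ g g = 0
    rw [hg, mul_one, sub_self]
  have h1 : inner ℝ (e i) (e j) = 0 := e.orthonormal.2 hij
  have h2 (k) : inner ℝ g (e k) ≠ 0 := by
    intro h
    have h3 := e.orthonormal.1 k
    rw [hpar (e k), h, zero_smul, norm_zero] at h3
    exact zero_ne_one h3
  rw [hpar (e i), hpar (e j), inner_smul_left, inner_smul_right, hg, conj_trivial, mul_one] at h1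
  exact mul_ne_zero (h2 i) (h2 j) h1

end Density

/-! ### Uniform form bounds and the main theorem. -/

theorem exists_inner_operator_le {h : ℝ → ℝ} {a : ℕ → ℝ} (hh : IsNonnegSeries h a) (τ : ℝ) :
    ∃ K : ℕ → ℝ, (∀ n, 0 ≤ K n) ∧ ∀ {d : ℕ} {σ : Fin d → ℝ≥0}, (∀ i, 0 < σ i) →
      ∑ i, (σ i : ℝ) ≤ τ → IsHilbertSchmidtKernel (innerProductKernel h d) (diagGaussian σ) →
      ∀ (n : ℕ) (B : Finset (Fin d → ℕ)), (∀ β ∈ B, ∑ i, β i = n) → ∀ (b : (Fin d → ℕ) → ℝ)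
        (A : Finset (Fin d → ℕ)), ∑ α ∈ A, a (∑ i, α i) * Nat.multinomial Finset.univ α *
          (inner ℝ (monomialLp σ α) (∑ β ∈ B, b β • hermiteLp σ β)) ^ 2
        ≤ K n * ∑ β ∈ B, (∏ i, (σ i : ℝ) ^ β i) * b β ^ 2 := by
  rcases (admissibleVariances a τ).eq_empty_or_nonempty with hemp | hne
  -- With no admissible variance only `d = 0` can occur. Then only `a 0` matters, and the general
  -- bound applies to the sequence truncated after it, with `M = a 0` and `r = 1`.
  · refine ⟨fun n => a 0 * 1 ^ n * 100 ^ n * Real.exp (10 * (1 * τ)), fun n => ?_,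
      fun {d σ} hσ hτ hk n B hB b A => ?_⟩
    · have := hh.nonneg 0
      positivity
    · have hd : IsEmpty (Fin d) := ⟨fun i => by
        have := mem_admissibleVariances hh hσ hτ hk i
        rw [hemp] at this
        exact this⟩
      refine le_trans (le_of_eq ?_) (sum_mul_inner_monomialLp_sq_le
        (a := fun m => if m = 0 then a 0 else 0) (hh.nonneg 0) one_pos (fun m => ?_) hσ
        (fun i => hd.elim i) hτ B hB b A)
      · simp
      · have := hh.nonneg 0
        split_ifs with hm
        · simp [hm]
        · simpa using this
  · obtain ⟨M, r, hM, hr, haM, hrs⟩ := exists_growth_bound hh.nonneg hne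
    refine ⟨fun n => M * r ^ n * 100 ^ n * Real.exp (10 * (r * τ)), fun n => by positivity,
      fun {d σ} hσ hτ hk n B hB b A => ?_⟩
    exact sum_mul_inner_monomialLp_sq_le hM hr haM hσ
      (fun i => hrs _ (mem_admissibleVariances hh hσ hτ hk i)) hτ B hB b A

theorem exists_sum_inner_sq_le_operator {a : ℕ → ℝ} (τ : ℝ) (n : ℕ)
    (hgood : ∀ m ≤ n, m ≡ n [MOD 2] → 0 < a m) :
    ∃ L : ℝ, 0 ≤ L ∧ ∀ {d : ℕ} {σ : Fin d → ℝ≥0}, (∀ i, 0 < σ i) → ∑ i, (σ i : ℝ) ≤ τ →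
      ∀ B : Finset (Fin d → ℕ), (∀ β ∈ B, ∑ i, β i = n) → ∀ f : Lp ℝ 2 (diagGaussian σ),
        ∃ A : Finset (Fin d → ℕ),
        ∑ β ∈ B, (∏ i, (σ i : ℝ) ^ β i) * (inner ℝ (hermiteLp σ β) f) ^ 2
          ≤ L * ∑ α ∈ A, a (∑ i, α i) * Nat.multinomial Finset.univ α *
            (inner ℝ (monomialLp σ α) f) ^ 2 := by
  obtain ⟨L, hL0, hL⟩ := exists_sum_inner_hermiteLp_sq_le τ n
  obtain ⟨δ, hδ0, hδ⟩ : ∃ δ > 0, ∀ m ≤ n, m ≡ n [MOD 2] → δ ≤ a m := by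
    set s := (Finset.range (n + 1)).filter fun m => m ≡ n [MOD 2]
    have hs : s.Nonempty := ⟨n, by simp [s, Nat.ModEq.refl]⟩
    obtain ⟨m₀, hm₀, hmin⟩ := s.exists_min_image a hs
    have hm₀' := Finset.mem_filter.1 hm₀
    refine ⟨a m₀, hgood m₀ (Nat.lt_succ_iff.1 (Finset.mem_range.1 hm₀'.1)) hm₀'.2,
      fun m hm hmod => hmin m ?_⟩
    exact Finset.mem_filter.2 ⟨Finset.mem_range.2 (Nat.lt_succ_of_le hm), hmod⟩
  refine ⟨L / δ, by positivity, fun {d σ} hσ hτ B hB f => ⟨parityIndices d n, ?_⟩⟩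
  refine (hL hσ hτ B hB f).trans ?_
  rw [div_mul_eq_mul_div, le_div_iff₀ hδ0, mul_assoc, Finset.sum_mul]
  refine mul_le_mul_of_nonneg_left (Finset.sum_le_sum fun α hα => ?_) hL0
  obtain ⟨-, hα1, hα2⟩ := Finset.mem_filter.1 hα
  have h1 : (1 : ℝ) ≤ Nat.multinomial Finset.univ α := by
    exact_mod_cast Nat.multinomial_pos Finset.univ α
  have h2 := hδ _ hα1 hα2
  rw [mul_comm]
  exact mul_le_mul_of_nonneg_right (by nlinarith) (sq_nonneg _)

theorem mainTheorem2 (h : ℝ → ℝ) (a : ℕ → ℝ) (hh : IsNonnegSeries h a) (τ : ℝ) :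
    ∃ C₁ C₂ : ℕ → ℝ, (∀ n, 0 < C₁ n) ∧ (∀ n, 0 < C₂ n) ∧
      ∀ (d : ℕ) (σ : Fin d → ℝ≥0), (∀ i, 0 < σ i) → ∑ i, (σ i : ℝ) ≤ τ →
        IsHilbertSchmidtKernel (innerProductKernel h d) (diagGaussian σ) →
        ∃ (e : HilbertBasis (Fin d → ℕ) ℝ (Lp ℝ 2 (diagGaussian σ)))
          (lam : (Fin d → ℕ) → ℝ),
          IsEigenbasis (innerProductKernel h d) (diagGaussian σ) e lam ∧
          ∀ β : Fin d → ℕ,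
            (∀ m ≤ ∑ i, β i, m ≡ ∑ i, β i [MOD 2] → 0 < a m) →
            C₁ (∑ i, β i) * ∏ i, (σ i : ℝ) ^ β i ≤ lam β ∧
              lam β ≤ C₂ (∑ i, β i) * ∏ i, (σ i : ℝ) ^ β i := by
  classical
  set good : ℕ → Prop := fun n => ∀ m ≤ n, m ≡ n [MOD 2] → 0 < a m with hgood
  obtain ⟨K, hK0, hK⟩ := exists_inner_operator_le hh τ
  have hLex (n : ℕ) : ∃ L : ℝ, 0 ≤ L ∧ (good n → ∀ {d : ℕ} {σ : Fin d → ℝ≥0}, (∀ i, 0 < σ i) →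
      ∑ i, (σ i : ℝ) ≤ τ → ∀ B : Finset (Fin d → ℕ), (∀ β ∈ B, ∑ i, β i = n) →
      ∀ f : Lp ℝ 2 (diagGaussian σ), ∃ A : Finset (Fin d → ℕ),
        ∑ β ∈ B, (∏ i, (σ i : ℝ) ^ β i) * (inner ℝ (hermiteLp σ β) f) ^ 2
          ≤ L * ∑ α ∈ A, a (∑ i, α i) * Nat.multinomial Finset.univ α *
            (inner ℝ (monomialLp σ α) f) ^ 2) := by
    by_cases hg : good n
    · obtain ⟨L, hL0, hL⟩ := exists_sum_inner_sq_le_operator τ n hg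
      exact ⟨L, hL0, fun _ => hL⟩
    · exact ⟨0, le_rfl, fun hg' => absurd hg' hg⟩
  choose L hL0 hL using hLex
  -- The choice of `s n` serves both injections: the bound with `K n` and `L n` is the error budget
  -- of the Hall selection, and the factorial bound is for the reverse injection.
  have hsex (n : ℕ) : ∃ s : ℝ, 0 < s ∧ s ≤ 1 / 2 ∧ 32 * s * (4 * K n + L n) ≤ (1 / 4) ^ (2 * n + 2)
      ∧ s ^ 2 ≤ 1 / (n.factorial : ℝ) := by
    have hX : 0 ≤ 4 * K n + L n := by
      have := hK0 n
      have := hL0 n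
      positivity
    set s := min (1 / 2 : ℝ) (min ((1 / 4) ^ (2 * n + 2) / (32 * (4 * K n + L n + 1)))
      (1 / (n.factorial : ℝ)))
    have hs0 : 0 < s := by positivity
    have hs1 : s ≤ 1 / 2 := min_le_left _ _
    have hs2 : s ≤ (1 / 4) ^ (2 * n + 2) / (32 * (4 * K n + L n + 1)) :=
      (min_le_right _ _).trans (min_le_left _ _)
    have hs3 : s ≤ 1 / (n.factorial : ℝ) := (min_le_right _ _).trans (min_le_right _ _)
    refine ⟨s, hs0, hs1, ?_, ?_⟩
    · rw [le_div_iff₀ (by positivity)] at hs2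
      nlinarith
    · nlinarith
  choose s hs hs' hsKL hsfac using hsex
  refine ⟨fun n => s n ^ 2, fun n => 1 / s n ^ 2, fun n => pow_pos (hs n) 2,
    fun n => one_div_pos.2 (pow_pos (hs n) 2), fun d σ hσ hτ hk => ?_⟩
  obtain ⟨T, hT, hTc, hTs, hlow, hup⟩ := exists_innerProductKernel_operator hh hk
  obtain ⟨J, e, lam, hlam⟩ := exists_hilbertBasis_eigenvectors T hTc hTs
  have hσ' (i : Fin d) : (0 : ℝ) < σ i := hσ i
  have hform (j : J) : inner ℝ (T (e j)) (e j) = lam j := by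
    rw [hlam, inner_smul_left, real_inner_self_eq_norm_sq, e.orthonormal.1]
    simp
  have hlam0 (j : J) : 0 ≤ lam j := by
    rw [← hform]
    simpa using hlow (e j) ∅
  -- When all coefficients are positive, a null vector of the form is orthogonal to every monomial,
  -- hence zero.
  have hlampos (hall : ∀ n, good n) (j : J) : 0 < lam j := by
    refine (hlam0 j).lt_of_ne fun h0 => ?_
    have hz : e j = 0 := by
      refine eq_zero_of_inner_monomialLp_eq_zero fun α => ?_
      have h1 := hlow (e j) {α}
      rw [hform, ← h0, Finset.sum_singleton] at h1
      have h2 : (0 : ℝ) < a (∑ i, α i) * Nat.multinomial Finset.univ α :=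
        mul_pos (hall _ _ le_rfl (Nat.ModEq.refl _))
          (by exact_mod_cast Nat.multinomial_pos Finset.univ α)
      have h3 := nonpos_of_mul_nonpos_right h1 h2
      nlinarith
    have h2 := e.orthonormal.1 j
    rw [hz, norm_zero] at h2
    exact zero_ne_one h2
  have hJ : Countable J := countable_index_of_hilbertBasis e
  obtain ⟨f, hf, hfR⟩ := exists_injective_eigenvalue_comparable hTs hlam hlam0
    (fun c hc => finite_setOf_le_eigenvalue T hTc e.orthonormal hlam hc)
    (orthonormal_hermiteLp hσ) (w := fun β : Fin d → ℕ => ∏ i, (σ i : ℝ) ^ β i)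
    (fun β => Finset.prod_pos fun i _ => pow_pos (hσ' i) _) (fun β => ∑ i, β i) good
    hK0 hL0 hs hs' hsKL
    (fun n _ B hB b => hup _ _ fun A => hK hσ hτ hk n B hB b A)
    (fun n hg B hB f => by
      obtain ⟨A, hA⟩ := hL n hg hσ hτ B hB f
      exact hA.trans (mul_le_mul_of_nonneg_left (hlow f A) (hL0 n)))
  obtain ⟨g, hg, hgR⟩ : ∃ g : J → (Fin d → ℕ), Function.Injective g ∧ ∀ j, good (∑ i, g j i) →
      s (∑ i, g j i) ^ 2 * ∏ i, (σ i : ℝ) ^ g j i ≤ lam j ∧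
        lam j ≤ (∏ i, (σ i : ℝ) ^ g j i) / s (∑ i, g j i) ^ 2 := by
    rcases eq_or_ne d 0 with rfl | hd
    · have := subsingleton_index_of_hilbertBasis e
      refine ⟨fun _ => 0, fun i j _ => Subsingleton.elim i j, fun j hj => ?_⟩
      rw [Subsingleton.elim j (f 0)]
      exact hfR 0 hj
    · refine exists_injective_multiIndex hd hσ' good (fun n l hn hnl => hn fun m hm hmod => ?_)
        hlampos (fun n => pow_pos (hs n) 2) hsfac
      refine hnl m (by omega) ?_
      simp only [Nat.ModEq] at hmod ⊢
      omega
  -- Each pair matched by the Schröder–Bernstein bijection comes from `f` or from the inverse of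
  -- `g`, so it inherits the eigenvalue bounds.
  obtain ⟨φ, hφ, hφR⟩ := Function.Embedding.schroeder_bernstein_of_rel hf hg
    (fun (β : Fin d → ℕ) j => good (∑ i, β i) →
      s (∑ i, β i) ^ 2 * ∏ i, (σ i : ℝ) ^ β i ≤ lam j ∧
        lam j ≤ (∏ i, (σ i : ℝ) ^ β i) / s (∑ i, β i) ^ 2) hfR hgR
  obtain ⟨e', he'⟩ := exists_reindex_hilbertBasis e hφ
  refine ⟨e', fun β => lam (φ β), fun β => ?_, fun β hβ => ?_⟩
  · refine (hT (e' β)).symm.trans ?_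
    rw [he', hlam]
    filter_upwards [Lp.coeFn_smul (lam (φ β)) (e (φ β))] with x hx
    rw [hx, Pi.smul_apply, smul_eq_mul]
  · obtain ⟨h1, h2⟩ := hφR β hβ
    refine ⟨h1, h2.trans (le_of_eq ?_)⟩
    ring
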